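/- For positive integers $n$ and $d$, let the Hamming torus of dimension $d$ be the graph on $[n]^d=\{1,\dots,n\}^d$ in which two vertices are adjacent iff they differ in exactly one coordinate. In bootstrap percolation with threshold $\theta\in\mathbb{N}$ each vertex is initially open independently with probability $p$; at each time step every vertex with at least $\theta$ open neighbors becomes open, and open vertices stay open forever. For $1\le i\le d$, an $i$-dimensional subgraph is the set of vertices obtained by fixing $d-i$ of the coordinates and letting the other $i$ coordinates vary over $[n]$. Let $p_c(i,d)=p_c(i,d;n,\theta)$ be the value of $p\in[0,1]$ for which the probability that all vertices of some $i$-dimensional subgraph are eventually open equals $1/2$. **Theorem.** For all $d\ge 3$ and $2\le i\le d$ there are constants $c,C>0$ (depending only on $i$ and $d$) and $\theta_0$ such that for every $\theta\ge\theta_0$ and all sufficiently large $n$ (depending on $i$, $d$, $\theta$), the threshold $p_c(i,d)$ exists and is unique, and $$n^{-1-\frac{2}{\theta}-\frac{C}{\theta^{3/2}}}\;\le\; p_c(i,d)\;\le\; n^{-1-\frac{2}{\theta}-\frac{c}{\theta^{3/2}}}.$$ In short, $p_c(i,d)=n^{-1-2/\theta-\Theta(\theta^{-3/2})}$. -/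

import Mathlib

namespace HammingBootstrap

/-- The Hamming torus with vertex set `[n]^d`: two vertices are adjacent iff they differ in
exactly one coordinate. -/
def hammingTorus (n d : ℕ) : SimpleGraph (Fin d → Fin n) where
  Adj v w := hammingDist v w = 1
  symm := ⟨fun v w h => by rw [hammingDist_comm]; exact h⟩
  loopless := ⟨fun v h => by simp at h⟩

/-- One step of bootstrap percolation with threshold `θ` on the graph `G`. A configuration is given
by its set `A` of open vertices; a vertex is open after the step iff it was open before or has at
least `θ` open neighbours. -/
def bootstrapStep {V : Type*} (G : SimpleGraph V) (θ : ℕ) (A : Set V) : Set V :=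
  {v | v ∈ A ∨ (θ : ℕ∞) ≤ (G.neighborSet v ∩ A).encard}

/-- The set of vertices open at time `j`, started from the set `A` of initially open vertices. -/
def openAt {V : Type*} (G : SimpleGraph V) (θ : ℕ) (A : Set V) (j : ℕ) : Set V :=
  (bootstrapStep G θ)^[j] A

/-- The set of vertices that are eventually open. As the sets `openAt G θ A j` increase with `j`,
this is the limit configuration of the process. -/
def finalOpen {V : Type*} (G : SimpleGraph V) (θ : ℕ) (A : Set V) : Set V :=
  ⋃ j : ℕ, openAt G θ A j

/-- `F` is the vertex set of an `i`-dimensional subgraph of the Hamming torus `[n]^d`: the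
coordinates in some set `S` of size `i` are free, and all the others are fixed. -/
def IsSubtorus {n d : ℕ} (i : ℕ) (F : Set (Fin d → Fin n)) : Prop :=
  ∃ (S : Finset (Fin d)) (a : Fin d → Fin n), S.card = i ∧ F = {v | ∀ j, j ∉ S → v j = a j}

/-- The event (as a set of initial configurations) that some `i`-dimensional subgraph is
eventually open. -/
def someSubtorusOpen (n d i θ : ℕ) : Set (Set (Fin d → Fin n)) :=
  {A | ∃ F, IsSubtorus i F ∧ F ⊆ finalOpen (hammingTorus n d) θ A}

/-- The probability that some `i`-dimensional subgraph is eventually open, when every vertex of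
`[n]^d` is initially open with probability `p`, independently of the others. -/
noncomputable def probSubtorusOpen (n d i θ : ℕ) (p : unitInterval) : ℝ :=
  (ProbabilityTheory.setBernoulli (Set.univ : Set (Fin d → Fin n)) p).real
    (someSubtorusOpen n d i θ)

/-- `p` is the threshold (critical probability) for some `i`-dimensional subgraph of `[n]^d` to
become open: at `p` this has probability exactly `1/2`. -/
def IsThreshold (n d i θ : ℕ) (p : unitInterval) : Prop :=
  probSubtorusOpen n d i θ p = 1 / 2

end HammingBootstrap

/-! Write `n * p = n ^ (-b)`. A given set of about `n` vertices (a line or a neighbourhood) contains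
`m` initially open ones with probability about `n ^ (-b * m)`. A plane has lines with `θ / 2` open
vertices at `b ≈ 2 / θ`; the correction `θ ^ (-3/2)` comes from working with about `√θ` such lines
at once.

Below the threshold (`probSubtorusOpen_lt_half`): with `R ≈ √θ`, consider the first time some plane
has `R` parallel lines, each with `d * R` newly opened vertices. Before that time vertices get
little help from others, so each of these lines contains `R` vertices that had all but `O(R)` of
their `θ` neighbours open at time zero (`le_ncard_almostOpen_of_heavy`). Hall's theorem selects `R`
such vertices in distinct rows and columns (`exists_almostOpen_transversal`); their neighbourhoods
are almost disjoint, so the events are nearly independent. There are `n ^ (d + 2 * R)` positions up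
to a constant, and the probability is about `n ^ (-b * R * (θ - O(R)))`. The positions cancel the
main term, and the correction in `b` has to beat `O(R ^ 2 / θ) = O(1)`, which a large multiple of `θ
^ (-3/2)` achieves.

Above the threshold (`eventually_half_lt_probSubtorusOpen`): let `s ≈ θ / 2` and `k ≈ √θ`. A plane
fills if in both directions it has `k` strong lines with `s` open vertices and `θ` weak lines with
`s - k` (`forall_of_strong_weak_lines`). Weak lines are abundant, and the strong ones together cost
at most `n ^ (1/4)`. Among the `n` parallel planes in a third direction, `θ` then fill with
probability exponentially close to one, and they open every vertex of a transversal line. A union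
bound over all vertices makes the whole torus open.

Existence and uniqueness hold because the probability is continuous and strictly increasing in `p`.
-/

open MeasureTheory ProbabilityTheory

namespace HammingBootstrap

/-! ### Random subsets: independence, union bounds, dependence on `p`. -/

section Bernoulli

/-- The law of a random subset of `V` containing each vertex independently with probability `p`. -/
noncomputable abbrev bernoulliSubset (V : Type*) (p : unitInterval) : Measure (Set V) :=
  setBernoulli (Set.univ : Set V) p

/-- The event `E` depends only on the restriction of the configuration to `T`. -/
def DeterminedBy {V : Type*} (E : Set (Set V)) (T : Set V) : Prop :=
  ∀ A B : Set V, (∀ v ∈ T, v ∈ A ↔ v ∈ B) → A ∈ E → B ∈ E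

theorem DeterminedBy.mono {V : Type*} {E : Set (Set V)} {S T : Set V} (h : DeterminedBy E S)
    (hST : S ⊆ T) : DeterminedBy E T :=
  fun A B hAB => h A B fun v hv => hAB v (hST hv)

theorem DeterminedBy.inter {V : Type*} {E F : Set (Set V)} {S T : Set V} (h : DeterminedBy E S)
    (h' : DeterminedBy F T) : DeterminedBy (E ∩ F) (S ∪ T) :=
  fun A B hAB hA => ⟨h A B (fun v hv => hAB v (Or.inl hv)) hA.1,
    h' A B (fun v hv => hAB v (Or.inr hv)) hA.2⟩

theorem DeterminedBy.compl {V : Type*} {E : Set (Set V)} {T : Set V} (h : DeterminedBy E T) :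
    DeterminedBy Eᶜ T :=
  fun A B hAB hA hB => hA (h B A (fun v hv => (hAB v hv).symm) hB)

theorem DeterminedBy.biInter {V ι : Type*} {E : ι → Set (Set V)} {T : ι → Set V} (s : Finset ι)
    (h : ∀ j ∈ s, DeterminedBy (E j) (T j)) :
    DeterminedBy (⋂ j ∈ s, E j) (⋃ j ∈ s, T j) := by
  intro A B hAB hA
  simp only [Set.mem_iInter] at hA ⊢
  exact fun j hj => h j hj A B (fun v hv => hAB v (Set.mem_biUnion hj hv)) (hA j hj)

theorem DeterminedBy.biUnion {V ι : Type*} {E : ι → Set (Set V)} {T : ι → Set V} (s : Finset ι)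
    (h : ∀ j ∈ s, DeterminedBy (E j) (T j)) :
    DeterminedBy (⋃ j ∈ s, E j) (⋃ j ∈ s, T j) := by
  intro A B hAB hA
  simp only [Set.mem_iUnion] at hA ⊢
  obtain ⟨j, hj, hA⟩ := hA
  exact ⟨j, hj, h j hj A B (fun v hv => hAB v (Set.mem_biUnion hj hv)) hA⟩

/-- Uniform labels realise all values of `p` on one probability space; the coupling behind
`bernoulliSubset_strictMono`. -/
theorem map_lt_volume (p : unitInterval) :
    (volume : Measure unitInterval).map (fun u => u < p) =
      unitInterval.toNNReal p • Measure.dirac (True) +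
        unitInterval.toNNReal (unitInterval.symm p) • Measure.dirac False := by
  have hm : Measurable (fun u : unitInterval => u < p) := measurableSet_Iio.mem
  refine Measure.ext_of_singleton fun a => ?_
  rw [Measure.map_apply hm (measurableSet_singleton _)]
  by_cases ha : a
  · have h1 : (fun u : unitInterval => u < p) ⁻¹' {a} = Set.Iio p := by
      ext u; simp [ha]
    rw [h1, unitInterval.volume_Iio]
    simp [ha, ENNReal.ofReal, Real.toNNReal_of_nonneg p.2.1]
    rfl
  · have h1 : (fun u : unitInterval => u < p) ⁻¹' {a} = Set.Ici p := by
      ext u; simp [ha]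
    rw [h1, unitInterval.volume_Ici]
    simp [ha, ENNReal.ofReal, Real.toNNReal_of_nonneg (unitInterval.symm p).2.1,
      ← unitInterval.coe_symm_eq]
    rfl

instance isProbabilityMeasure_bernoulliProp (p : unitInterval) : IsProbabilityMeasure
    (unitInterval.toNNReal p • Measure.dirac (True) +
        unitInterval.toNNReal (unitInterval.symm p) • Measure.dirac False) := by
  rw [← map_lt_volume]
  exact Measure.isProbabilityMeasure_map (by
    have hm : Measurable (fun u : unitInterval => u < p) := measurableSet_Iio.mem
    exact hm.aemeasurable)

theorem bernoulliSubset_apply {V : Type*} (p : unitInterval) (E : Set (Set V)) :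
    bernoulliSubset V p E = Measure.infinitePi (fun _ : V =>
      unitInterval.toNNReal p • Measure.dirac (True) +
        unitInterval.toNNReal (unitInterval.symm p) • Measure.dirac False)
      ((fun ω : V → Prop => {v | ω v}) ⁻¹' E) := by
  rw [bernoulliSubset, setBernoulli_apply']
  simp

theorem bernoulliSubset_apply_uniform {V : Type*} [Finite V] (p : unitInterval)
    (E : Set (Set V)) :
    bernoulliSubset V p E = Measure.infinitePi (fun _ : V => (volume : Measure unitInterval))
      {U | {v | U v < p} ∈ E} := by
  have hm : Measurable (fun u : unitInterval => u < p) := measurableSet_Iio.mem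
  have hm' : Measurable (fun (U : V → unitInterval) v => U v < p) :=
    measurable_pi_lambda _ fun v => hm.comp (measurable_pi_apply v)
  rw [bernoulliSubset_apply]
  simp_rw [← map_lt_volume]
  rw [← Measure.infinitePi_map_pi (fun _ : V => (volume : Measure unitInterval)) (fun _ => hm),
    Measure.map_apply hm' .of_discrete]
  rfl

theorem DeterminedBy.preimage_eq {V : Type*} {E : Set (Set V)} {S : Finset V}
    (h : DeterminedBy E S) : (fun ω : V → Prop => {v | ω v}) ⁻¹' E =
      (fun (ω : V → Prop) (v : S) => ω v) ⁻¹' {η | {v | ∃ h : v ∈ S, η ⟨v, h⟩} ∈ E} := by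
  ext ω
  simp only [Set.mem_preimage, Set.mem_ofPred_eq]
  constructor
  · refine h _ _ fun v hv => ?_
    have : v ∈ S := hv
    simp [this]
  · refine h _ _ fun v hv => ?_
    have : v ∈ S := hv
    simp [this]

theorem bernoulliSubset_inter {V : Type*} [Finite V] (p : unitInterval) {E F : Set (Set V)}
    {S T : Set V} (hE : DeterminedBy E S) (hF : DeterminedBy F T) (hST : Disjoint S T) :
    (bernoulliSubset V p).real (E ∩ F) =
      (bernoulliSubset V p).real E * (bernoulliSubset V p).real F := by
  classical
  obtain ⟨S, rfl⟩ := S.toFinite.exists_finset_coe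
  obtain ⟨T, rfl⟩ := T.toFinite.exists_finset_coe
  have hi := iIndepFun_infinitePi (P := fun _ : V =>
      unitInterval.toNNReal p • Measure.dirac (True) +
        unitInterval.toNNReal (unitInterval.symm p) • Measure.dirac False)
      (X := fun _ => id) (fun _ => measurable_id)
  have h2 := hi.indepFun_finset S T (Finset.disjoint_coe.1 hST) (fun v => measurable_pi_apply v)
  have h3 := h2.measure_inter_preimage_eq_mul {η | {v | ∃ h : v ∈ S, η ⟨v, h⟩} ∈ E}
    {η | {v | ∃ h : v ∈ T, η ⟨v, h⟩} ∈ F} .of_discrete .of_discrete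
  simp only [measureReal_def, ← ENNReal.toReal_mul]
  congr 1
  rw [bernoulliSubset_apply, bernoulliSubset_apply, bernoulliSubset_apply, Set.preimage_inter,
    hE.preimage_eq, hF.preimage_eq]
  exact h3

theorem bernoulliSubset_biInter {V ι : Type*} [Finite V] (p : unitInterval) (s : Finset ι)
    {E : ι → Set (Set V)} {T : ι → Set V} (hE : ∀ j ∈ s, DeterminedBy (E j) (T j))
    (hT : (s : Set ι).PairwiseDisjoint T) :
    (bernoulliSubset V p).real (⋂ j ∈ s, E j) = ∏ j ∈ s, (bernoulliSubset V p).real (E j) := by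
  classical
  induction s using Finset.induction_on with
  | empty => simp
  | insert a s ha ih =>
    rw [Finset.prod_insert ha, Finset.set_biInter_insert,
      bernoulliSubset_inter p (hE a (Finset.mem_insert_self _ _))
        (DeterminedBy.biInter s fun j hj => hE j (Finset.mem_insert_of_mem hj)),
      ih (fun j hj => hE j (Finset.mem_insert_of_mem hj)) (hT.subset (by simp))]
    simp only [Set.disjoint_iUnion_right]
    exact fun j hj => hT (by simp) (by simp [hj]) fun h => ha (h ▸ hj)

theorem bernoulliSubset_mem {V : Type*} [Finite V] (p : unitInterval) (v : V) :
    (bernoulliSubset V p).real {A | v ∈ A} = p := by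
  rw [measureReal_def, bernoulliSubset_apply]
  have := measurePreserving_eval_infinitePi (fun _ : V =>
      unitInterval.toNNReal p • Measure.dirac (True) +
        unitInterval.toNNReal (unitInterval.symm p) • Measure.dirac False) v
  have h2 := this.measure_preimage (s := {True}) (by measurability)
  have h3 : (fun ω : V → Prop => ({v | ω v} : Set V)) ⁻¹' {A | v ∈ A} =
      (Function.eval v : (V → Prop) → Prop) ⁻¹' {True} := by
    ext ω; simp
  rw [h3, h2]
  simp

theorem determinedBy_mem {V : Type*} (v : V) : DeterminedBy {A : Set V | v ∈ A} {v} :=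
  fun _ _ hAB hA => (hAB v rfl).1 hA

theorem bernoulliSubset_subset {V : Type*} [Finite V] (p : unitInterval) (U : Finset V) :
    (bernoulliSubset V p).real {A | (U : Set V) ⊆ A} = (p : ℝ) ^ U.card := by
  have h : {A : Set V | (U : Set V) ⊆ A} = ⋂ v ∈ U, {A | v ∈ A} := by
    ext A; simp [Set.subset_def]
  rw [h, bernoulliSubset_biInter p U (fun v _ => determinedBy_mem v)]
  · simp only [bernoulliSubset_mem, Finset.prod_const]
  · intro a _ b _ hab
    simpa using hab

/-- Union bound over the `u`-element subsets of `T`, whose number is at most `T.card ^ u`. -/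
theorem bernoulliSubset_le_ncard_inter {V : Type*} [Finite V] (p : unitInterval) (T : Finset V)
    (u : ℕ) :
    (bernoulliSubset V p).real {A | u ≤ ((T : Set V) ∩ A).ncard} ≤ (T.card * p : ℝ) ^ u := by
  classical
  have h : {A : Set V | u ≤ ((T : Set V) ∩ A).ncard} ⊆
      ⋃ U ∈ T.powersetCard u, {A | (U : Set V) ⊆ A} := by
    intro A hA
    obtain ⟨W, hW, hWu⟩ := Set.exists_subset_card_eq hA
    obtain ⟨W, rfl⟩ := W.toFinite.exists_finset_coe
    rw [Set.ncard_coe_finset] at hWu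
    simp only [Set.mem_iUnion]
    refine ⟨W, Finset.mem_powersetCard.2 ⟨?_, hWu⟩, hW.trans Set.inter_subset_right⟩
    exact_mod_cast hW.trans Set.inter_subset_left
  refine (measureReal_mono h (measure_ne_top _ _)).trans ((measureReal_biUnion_finset_le _ _).trans ?_)
  simp only [bernoulliSubset_subset]
  rw [Finset.sum_congr rfl fun U hU => by rw [(Finset.mem_powersetCard.1 hU).2],
    Finset.sum_const, Finset.card_powersetCard, nsmul_eq_mul, mul_pow]
  have := p.2.1
  gcongr
  exact_mod_cast Nat.choose_le_pow _ _

theorem one_sub_pow_le_exp {x : ℝ} (hx1 : x ≤ 1) (g : ℕ) :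
    (1 - x) ^ g ≤ Real.exp (-(x * g)) := by
  calc (1 - x) ^ g ≤ Real.exp (-x) ^ g :=
        pow_le_pow_left₀ (by linarith) (by linarith [Real.add_one_le_exp (-x)]) _
    _ = Real.exp (-(x * g)) := by rw [← Real.exp_nat_mul]; ring_nf

/-- The complementary bound `g * x / (1 + g * x)` is of the right order whether successes are rare
or abundant, so strong and weak lines can be treated alike. -/
theorem one_sub_pow_le_inv {x : ℝ} (hx0 : 0 ≤ x) (hx1 : x ≤ 1) (g : ℕ) :
    (1 - x) ^ g ≤ 1 / (1 + g * x) := by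
  refine (one_sub_pow_le_exp hx1 g).trans ?_
  rw [Real.exp_neg, ← one_div]
  have : 0 ≤ g * x := by positivity
  gcongr
  linarith [Real.add_one_le_exp (x * g)]

theorem bernoulliSubset_exists_ge {V ι : Type*} [Finite V] (p : unitInterval) (s : Finset ι)
    {E : ι → Set (Set V)} {T : ι → Set V} (hE : ∀ j ∈ s, DeterminedBy (E j) (T j))
    (hT : (s : Set ι).PairwiseDisjoint T) {x : ℝ}
    (hxE : ∀ j ∈ s, x ≤ (bernoulliSubset V p).real (E j)) :
    1 - (1 - x) ^ s.card ≤ (bernoulliSubset V p).real (⋃ j ∈ s, E j) := by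
  have h := bernoulliSubset_biInter p s (fun j hj => (hE j hj).compl) hT
  have h2 : (⋃ j ∈ s, E j) = (⋂ j ∈ s, (E j)ᶜ)ᶜ := by simp
  rw [h2, probReal_compl_eq_one_sub .of_discrete, h]
  gcongr
  rw [← Finset.prod_const]
  refine Finset.prod_le_prod (fun j _ => measureReal_nonneg) fun j hj => ?_
  rw [probReal_compl_eq_one_sub .of_discrete]
  linarith [hxE j hj]

/-- Asking for one success in each of several disjoint blocks, instead of a number of successes
overall, turns a binomial tail into a product of independent factors. -/
theorem bernoulliSubset_blocks {V ι κ : Type*} [Finite V] (p : unitInterval) (s : Finset κ)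
    (B : κ → Finset ι) (hB : (s : Set κ).PairwiseDisjoint B)
    {E : κ → ι → Set (Set V)} {T : ι → Set V}
    (hE : ∀ j ∈ s, ∀ x ∈ B j, DeterminedBy (E j x) (T x))
    (hT : Pairwise (Function.onFun Disjoint T)) (q : κ → ℝ) (hq : ∀ j, 0 ≤ q j)
    (hqE : ∀ j ∈ s, ∀ x ∈ B j, q j ≤ (bernoulliSubset V p).real (E j x)) :
    ∏ j ∈ s, (((B j).card * q j) / (1 + (B j).card * q j)) ≤
      (bernoulliSubset V p).real (⋂ j ∈ s, ⋃ x ∈ B j, E j x) := by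
  rw [bernoulliSubset_biInter p s (T := fun j => ⋃ x ∈ B j, T x)
    (fun j hj => DeterminedBy.biUnion _ (hE j hj))]
  · refine Finset.prod_le_prod (fun j _ => ?_) fun j hj => ?_
    · have := hq j
      positivity
    · refine le_trans ?_ (bernoulliSubset_exists_ge p (B j) (hE j hj) (fun a _ b _ h => hT h)
        (hqE j hj))
      have h0 := hq j
      rcases (B j).eq_empty_or_nonempty with h | ⟨x, hx⟩
      · simp [h]
      · have h1 : q j ≤ 1 := (hqE j hj x hx).trans measureReal_le_one
        have h2 := one_sub_pow_le_inv h0 h1 (B j).card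
        have h3 : (B j).card * q j / (1 + (B j).card * q j) =
            1 - 1 / (1 + (B j).card * q j) := by
          have : 0 < 1 + (B j).card * q j := by positivity
          field_simp
          ring
        linarith
  · intro i hi j hj hij
    simp only [Function.onFun, Set.disjoint_iUnion_left, Set.disjoint_iUnion_right]
    intro x hx y hy
    exact hT fun h => Finset.disjoint_left.1 (hB hi hj hij) hy (h ▸ hx)

/-- In the uniform coupling the gain is strict: with positive probability all labels lie in `[p,
q)`, and then the configuration is empty at `p` and full at `q`. -/
theorem bernoulliSubset_strictMono {V : Type*} [Finite V] {E : Set (Set V)}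
    (hE : ∀ A B : Set V, A ⊆ B → A ∈ E → B ∈ E) (h0 : ∅ ∉ E) (h1 : Set.univ ∈ E) :
    StrictMono fun p => (bernoulliSubset V p).real E := by
  classical
  have := Fintype.ofFinite V
  intro p q hpq
  have hlt (r : unitInterval) : Measurable fun (U : V → unitInterval) => {v | U v < r} := by
    have hm : Measurable (fun u : unitInterval => u < r) := measurableSet_Iio.mem
    have h2 : Measurable (fun (U : V → unitInterval) v => U v < r) :=
      measurable_pi_lambda _ fun v => hm.comp (measurable_pi_apply v)
    have h3 : Measurable fun ω : V → Prop => {v | ω v} := .of_discrete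
    exact h3.comp h2
  simp only [measureReal_def, bernoulliSubset_apply_uniform]
  set ν := Measure.infinitePi (fun _ : V => (volume : Measure unitInterval)) with hν
  have hsub : {U : V → unitInterval | {v | U v < p} ∈ E} ∪ Set.univ.pi (fun _ => Set.Ico p q) ⊆
      {U | {v | U v < q} ∈ E} := by
    rintro U (hU | hU)
    · exact hE _ _ (fun v hv => lt_trans (show U v < p from hv) hpq) hU
    · have : {v | U v < q} = Set.univ := by
        ext v; simpa using (hU v trivial).2
      simpa [this] using h1
  have hdisj : Disjoint {U : V → unitInterval | {v | U v < p} ∈ E}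
      (Set.univ.pi (fun _ => Set.Ico p q)) := by
    rw [Set.disjoint_left]
    intro U hU hU'
    have : {v | U v < p} = ∅ := by
      ext v; simpa using (hU' v trivial).1
    exact h0 (by simpa [this] using hU)
  have hpos : 0 < ν (Set.univ.pi (fun _ => Set.Ico p q)) := by
    rw [hν, Measure.infinitePi_pi_univ]
    · simp only [unitInterval.volume_Ico, tprod_fintype]
      rw [pos_iff_ne_zero, Finset.prod_ne_zero_iff]
      intro v _
      simpa using hpq
    · exact fun _ => measurableSet_Ico
  have h2 := measure_mono (μ := ν) hsub
  rw [measure_union hdisj (MeasurableSet.univ_pi fun _ => measurableSet_Ico)] at h2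
  rw [ENNReal.toReal_lt_toReal (measure_ne_top _ _) (measure_ne_top _ _)]
  exact (ENNReal.lt_add_right (measure_ne_top _ _) hpos.ne').trans_le h2

theorem bernoulliSubset_continuous {V : Type*} [Finite V] (E : Set (Set V)) :
    Continuous fun p => (bernoulliSubset V p).real E := by
  classical
  have := Fintype.ofFinite V
  have h (p : unitInterval) : (bernoulliSubset V p).real E =
      ∑ A ∈ E.toFinite.toFinset, (p : ℝ) ^ A.ncard * (1 - p : ℝ) ^ (Set.univ \ A).ncard := by
    rw [← Set.Finite.coe_toFinset E.toFinite, ← sum_measureReal_singleton]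
    · simp
  simp only [h]
  fun_prop

end Bernoulli

/-! ### Bootstrap percolation on an arbitrary graph. -/

section Dynamics

variable {V : Type*} {G : SimpleGraph V} {θ : ℕ} {A B : Set V}

theorem openAt_succ (j : ℕ) : openAt G θ A (j + 1) = bootstrapStep G θ (openAt G θ A j) :=
  Function.iterate_succ_apply' _ _ _

theorem openAt_mono : Monotone (openAt G θ A) := by
  refine monotone_nat_of_le_succ fun j => ?_
  rw [openAt_succ]
  exact fun v hv => Or.inl hv

theorem openAt_mono_initial (h : A ⊆ B) (j : ℕ) : openAt G θ A j ⊆ openAt G θ B j := by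
  induction j with
  | zero => exact h
  | succ j ih =>
    rw [openAt_succ, openAt_succ]
    rintro v (hv | hv)
    · exact Or.inl (ih hv)
    · exact Or.inr (hv.trans (Set.encard_le_encard (Set.inter_subset_inter_right _ ih)))

theorem subset_finalOpen : A ⊆ finalOpen G θ A :=
  fun _ hv => Set.mem_iUnion.2 ⟨0, hv⟩

theorem finalOpen_mono_initial (h : A ⊆ B) : finalOpen G θ A ⊆ finalOpen G θ B :=
  Set.iUnion_mono fun j => openAt_mono_initial h j

theorem exists_subset_openAt {S : Finset V} (hS : (S : Set V) ⊆ finalOpen G θ A) :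
    ∃ j, (S : Set V) ⊆ openAt G θ A j := by
  classical
  induction S using Finset.induction_on with
  | empty => exact ⟨0, by simp⟩
  | insert a S _ ih =>
    rw [Finset.coe_insert, Set.insert_subset_iff] at hS
    obtain ⟨j, hj⟩ := ih hS.2
    obtain ⟨k, hk⟩ := Set.mem_iUnion.1 hS.1
    refine ⟨max j k, ?_⟩
    rw [Finset.coe_insert, Set.insert_subset_iff]
    exact ⟨openAt_mono (le_max_right _ _) hk, hj.trans (openAt_mono (le_max_left _ _))⟩

/-- The case `w = v` is harmless, since then `v` is already open; allowing it lets `S` be taken from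
a whole line through `v`. -/
theorem mem_finalOpen_of_le_card {v : V} {S : Finset V} (hS : (S : Set V) ⊆ finalOpen G θ A)
    (hadj : ∀ w ∈ S, w = v ∨ G.Adj v w) (hcard : θ ≤ S.card) : v ∈ finalOpen G θ A := by
  by_cases hv : v ∈ S
  · exact hS hv
  obtain ⟨j, hj⟩ := exists_subset_openAt hS
  refine Set.mem_iUnion.2 ⟨j + 1, ?_⟩
  rw [openAt_succ]
  have hsub : (S : Set V) ⊆ G.neighborSet v ∩ openAt G θ A j :=
    fun w hw => ⟨(hadj w hw).resolve_left fun h => hv (h ▸ hw), hj hw⟩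
  refine Or.inr ?_
  calc (θ : ℕ∞) ≤ (S : Set V).encard := by
        rw [Set.encard_coe_eq_coe_finsetCard]; exact_mod_cast hcard
    _ ≤ _ := Set.encard_le_encard hsub

/-- A vertex that becomes open by time `j + 1` without being initially open has at least `θ` open
neighbours at time `j`. -/
theorem le_encard_of_mem_openAt_succ {v : V} {j : ℕ} (hv : v ∈ openAt G θ A (j + 1))
    (hvA : v ∉ A) : (θ : ℕ∞) ≤ (G.neighborSet v ∩ openAt G θ A j).encard := by
  induction j with
  | zero => exact hv.resolve_left hvA
  | succ j ih =>
    rw [openAt_succ] at hv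
    rcases hv with hv | hv
    · exact (ih hv).trans (Set.encard_le_encard
        (Set.inter_subset_inter_right _ (openAt_mono (Nat.le_succ j))))
    · exact hv

theorem finalOpen_empty (hθ : 0 < θ) : finalOpen G θ ∅ = ∅ := by
  refine Set.iUnion_eq_empty.2 fun j => ?_
  induction j with
  | zero => rfl
  | succ j ih =>
    rw [openAt_succ, ih]
    simp [bootstrapStep, hθ.ne']

end Dynamics

/-! ### Adjacency in the torus; existence and uniqueness of the threshold. -/

section Torus

variable {n d : ℕ}

theorem adj_update {v : Fin d → Fin n} {e : Fin d} {x : Fin n} (hx : x ≠ v e) :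
    (hammingTorus n d).Adj v (Function.update v e x) := by
  change hammingDist _ _ = 1
  rw [hammingDist, Finset.card_eq_one]
  refine ⟨e, ?_⟩
  ext j
  by_cases hj : j = e
  · subst hj; simpa using hx.symm
  · simp [hj]

theorem exists_eq_update_of_adj {v w : Fin d → Fin n} (h : (hammingTorus n d).Adj v w) :
    ∃ e x, x ≠ v e ∧ w = Function.update v e x := by
  change hammingDist _ _ = 1 at h
  rw [hammingDist, Finset.card_eq_one] at h
  obtain ⟨e, he⟩ := h
  have h (j : Fin d) : v j ≠ w j ↔ j = e := by
    have := Finset.ext_iff.1 he j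
    simpa using this
  refine ⟨e, w e, ((h e).2 rfl).symm, ?_⟩
  ext j
  by_cases hj : j = e
  · subst hj; simp
  · simp only [Function.update_of_ne hj]
    by_contra hne
    exact hj ((h j).1 fun h' => hne (by rw [h']))

theorem someSubtorusOpen_mono {i θ : ℕ} {A B : Set (Fin d → Fin n)} (hAB : A ⊆ B)
    (hA : A ∈ someSubtorusOpen n d i θ) : B ∈ someSubtorusOpen n d i θ := by
  obtain ⟨F, hF, hFA⟩ := hA
  exact ⟨F, hF, hFA.trans (finalOpen_mono_initial hAB)⟩

theorem mem_someSubtorusOpen_of_finalOpen_eq_univ {i θ : ℕ} (hid : i ≤ d) (hn : 0 < n)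
    {A : Set (Fin d → Fin n)} (h : finalOpen (hammingTorus n d) θ A = Set.univ) :
    A ∈ someSubtorusOpen n d i θ := by
  obtain ⟨S, -, hS⟩ := Finset.exists_subset_card_eq (s := (Finset.univ : Finset (Fin d))) (n := i)
    (by simpa using hid)
  exact ⟨_, ⟨S, fun _ => ⟨0, hn⟩, hS, rfl⟩, by simp [h]⟩

theorem empty_notMem_someSubtorusOpen {i θ : ℕ} (hθ : 0 < θ) :
    ∅ ∉ someSubtorusOpen n d i θ := by
  rintro ⟨F, ⟨S, a, -, rfl⟩, hF⟩
  rw [finalOpen_empty hθ] at hF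
  exact hF (show a ∈ _ from fun _ _ => rfl)

theorem probSubtorusOpen_strictMono {i θ : ℕ} (hid : i ≤ d) (hn : 0 < n) (hθ : 0 < θ) :
    StrictMono (probSubtorusOpen n d i θ) :=
  bernoulliSubset_strictMono (fun _ _ hAB hA => someSubtorusOpen_mono hAB hA)
    (empty_notMem_someSubtorusOpen hθ) (mem_someSubtorusOpen_of_finalOpen_eq_univ hid hn
      (Set.univ_subset_iff.1 subset_finalOpen))

theorem existsUnique_isThreshold {i θ : ℕ} (hid : i ≤ d) (hn : 0 < n) (hθ : 0 < θ) :
    ∃! p, IsThreshold n d i θ p := by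
  have hc : Continuous (probSubtorusOpen n d i θ) := bernoulliSubset_continuous _
  have h0 : probSubtorusOpen n d i θ 0 = 0 := by
    simp [probSubtorusOpen, measureReal_def, empty_notMem_someSubtorusOpen hθ]
  have h1 : probSubtorusOpen n d i θ 1 = 1 := by
    simp [probSubtorusOpen, measureReal_def, mem_someSubtorusOpen_of_finalOpen_eq_univ hid hn
      (Set.univ_subset_iff.1 subset_finalOpen)]
  obtain ⟨p, hp⟩ := mem_range_of_exists_le_of_exists_ge hc (c := 1 / 2) ⟨0, by rw [h0]; norm_num⟩
    ⟨1, by rw [h1]; norm_num⟩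
  exact ⟨p, hp, fun q hq => (probSubtorusOpen_strictMono hid hn hθ).injective
    (Eq.trans hq hp.symm)⟩

end Torus

/-! ### Lower bound: the structure forced by the first crowded plane. -/

section NewlyOpen

variable {n d : ℕ}

/-- The vertices that are open at time `t` but not initially open. -/
def newlyOpen (θ : ℕ) (A : Set (Fin d → Fin n)) (t : ℕ) : Set (Fin d → Fin n) :=
  openAt (hammingTorus n d) θ A t \ A

/-- The line through `v` in direction `e` contains at least `M` newly open vertices. -/
def Heavy (θ : ℕ) (A : Set (Fin d → Fin n)) (M t : ℕ) (v : Fin d → Fin n) (e : Fin d) : Prop :=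
  M ≤ {x : Fin n | Function.update v e x ∈ newlyOpen θ A t}.ncard

/-- Some two-dimensional subgraph contains `R` parallel heavy lines. -/
def Crowded (θ : ℕ) (A : Set (Fin d → Fin n)) (M R t : ℕ) : Prop :=
  ∃ (v : Fin d → Fin n) (e e' : Fin d), e ≠ e' ∧
    R ≤ {z : Fin n | Heavy θ A M t (Function.update v e' z) e}.ncard

/-- The vertex `w` has all but `D` of the `θ` open neighbours it needs already at time zero. -/
def AlmostOpen (θ : ℕ) (A : Set (Fin d → Fin n)) (D : ℕ) (w : Fin d → Fin n) : Prop :=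
  θ ≤ ((hammingTorus n d).neighborSet w ∩ A).ncard + D

/-- The neighbours of `w` lie on `d` lines, each contributing fewer than `M` newly open vertices;
the rest of the `θ` must have been open initially. -/
theorem almostOpen_of_not_heavy {θ M t : ℕ} {A : Set (Fin d → Fin n)} {w : Fin d → Fin n}
    (hw : w ∈ newlyOpen θ A (t + 1)) (h : ∀ e, ¬ Heavy θ A M t w e) :
    AlmostOpen θ A (d * M) w := by
  have h1 := le_encard_of_mem_openAt_succ hw.1 hw.2
  rw [← (Set.toFinite _).cast_ncard_eq] at h1
  have h1 := Nat.cast_le.1 h1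
  have hsub : (hammingTorus n d).neighborSet w ∩ openAt (hammingTorus n d) θ A t ⊆
      ((hammingTorus n d).neighborSet w ∩ A) ∪
      ⋃ e, Function.update w e '' {x | Function.update w e x ∈ newlyOpen θ A t} := by
    rintro y ⟨hy, hyt⟩
    by_cases hyA : y ∈ A
    · exact Or.inl ⟨hy, hyA⟩
    · obtain ⟨e, x, -, rfl⟩ := exists_eq_update_of_adj hy
      exact Or.inr (Set.mem_iUnion.2 ⟨e, x, ⟨hyt, hyA⟩, rfl⟩)
  have h2 : (⋃ e, Function.update w e '' {x | Function.update w e x ∈ newlyOpen θ A t}).ncard ≤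
      d * M := by
    refine (Set.ncard_iUnion_le_of_fintype _).trans ?_
    calc _ ≤ ∑ _e : Fin d, M := Finset.sum_le_sum fun e _ => ?_
      _ = d * M := by simp
    exact (Set.ncard_image_le (Set.toFinite _)).trans (not_le.1 (h e)).le
  exact h1.trans ((Set.ncard_le_ncard hsub (Set.toFinite _)).trans
    ((Set.ncard_union_le _ _).trans (Nat.add_le_add_left h2 _)))

/-- As long as no two-dimensional subgraph was crowded, a heavy line contains many vertices that
were almost open from the start. -/
theorem le_ncard_almostOpen_of_heavy {θ R t : ℕ} (hR : 0 < R) {A : Set (Fin d → Fin n)}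
    (hc : ∀ r < t, ¬ Crowded θ A (d * R) R r) {v : Fin d → Fin n} {e : Fin d}
    (h : Heavy θ A (d * R) t v e) :
    R ≤ {x : Fin n | AlmostOpen θ A (d * (d * R)) (Function.update v e x)}.ncard := by
  classical
  have hd : 0 < d := e.pos
  induction t with
  | zero =>
    have : {x : Fin n | Function.update v e x ∈ newlyOpen θ A 0} = ∅ := by
      ext x
      simp [newlyOpen, openAt]
    rw [Heavy, this, Set.ncard_empty] at h
    exact absurd h (not_le.2 (Nat.mul_pos hd hR))
  | succ t ih =>
    by_contra hlt
    rw [not_le] at hlt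
    -- The newly open vertices of the line are covered by `d` sets of fewer than `R` elements each,
    -- contradicting heaviness. For `e' ≠ e`, the heavy lines in direction `e'` that cross this line
    -- are parallel in one plane, so fewer than `R` of them exist before crowding.
    let f : Fin d → Set (Fin n) := fun e' =>
      if e' = e then {x | AlmostOpen θ A (d * (d * R)) (Function.update v e x)}
      else {x | Heavy θ A (d * R) t (Function.update v e x) e'}
    have hf (e' : Fin d) : (f e').ncard < R := by
      by_cases he : e' = e
      · simpa [f, he] using hlt
      · have := hc t (Nat.lt_succ_self t)
        simp only [Crowded, not_exists, not_and, not_le] at this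
        simpa [f, he] using this v e' e he
    have hsub : {x : Fin n | Function.update v e x ∈ newlyOpen θ A (t + 1)} ⊆ ⋃ e', f e' := by
      intro x hx
      rw [Set.mem_iUnion]
      by_contra hno
      rw [not_exists] at hno
      -- Had the line itself been heavy one step earlier, the induction hypothesis would already
      -- give the `R` almost open vertices.
      have he : ¬ Heavy θ A (d * R) t (Function.update v e x) e := fun he =>
        hlt.not_ge (ih (fun r hr => hc r (hr.trans (Nat.lt_succ_self t)))
          (by simpa [Heavy] using he))
      refine hno e ?_
      simp only [f, if_true]
      refine almostOpen_of_not_heavy hx fun e' => ?_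
      by_cases hee : e' = e
      · rwa [hee]
      · have := hno e'
        simpa [f, hee] using this
    have h1 : d * R ≤ ∑ e', (f e').ncard := le_trans (le_trans h
      (Set.ncard_le_ncard hsub (Set.toFinite _))) (Set.ncard_iUnion_le_of_fintype _)
    have h2 : ∑ e', (f e').ncard < ∑ _e' : Fin d, R :=
      Finset.sum_lt_sum_of_nonempty ⟨e, Finset.mem_univ e⟩ fun e' _ => hf e'
    simp only [Finset.sum_const, Finset.card_univ, Fintype.card_fin, smul_eq_mul] at h2
    omega

/-- As `2 ≤ i`, the open subgraph contains a plane. It is fully open at some finite time, and every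
line in it had at least `M` vertices not open initially, so all its lines are heavy. -/
theorem exists_crowded {i θ M R : ℕ} (hi : 2 ≤ i) (hR : R ≤ n) {A : Set (Fin d → Fin n)}
    (hA : ∀ (v : Fin d → Fin n) (e : Fin d), {x | Function.update v e x ∈ A}.ncard + M ≤ n)
    (h : A ∈ someSubtorusOpen n d i θ) : ∃ t, Crowded θ A M R t := by
  classical
  obtain ⟨_, ⟨S, a, hS, rfl⟩, hF⟩ := h
  obtain ⟨e, he, e', he', hee⟩ := Finset.one_lt_card.1 (by omega : 1 < S.card)
  have hfin := Set.toFinite {v : Fin d → Fin n | ∀ j, j ∉ S → v j = a j}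
  obtain ⟨t, ht⟩ := exists_subset_openAt (S := hfin.toFinset) (by simpa using hF)
  refine ⟨t, a, e, e', hee, ?_⟩
  have huniv : {z : Fin n | Heavy θ A M t (Function.update a e' z) e} = Set.univ := by
    refine Set.eq_univ_of_forall fun z => ?_
    have h1 : {x : Fin n | Function.update (Function.update a e' z) e x ∈ newlyOpen θ A t} =
        {x | Function.update (Function.update a e' z) e x ∈ A}ᶜ := by
      ext x
      refine ⟨fun hx => hx.2, fun hx => ⟨ht ?_, hx⟩⟩
      simp only [Set.Finite.coe_toFinset, Set.mem_ofPred_eq]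
      intro j hj
      rw [Function.update_of_ne (by rintro rfl; exact hj he),
        Function.update_of_ne (by rintro rfl; exact hj he')]
    have h2 := Set.ncard_add_ncard_compl
      {x | Function.update (Function.update a e' z) e x ∈ A}
    have h3 := hA (Function.update a e' z) e
    rw [Nat.card_eq_fintype_card, Fintype.card_fin] at h2
    change M ≤ _
    rw [h1]
    omega
  rw [huniv, Set.ncard_univ]
  simpa using hR

/-- At the first crowded time each of the `R` heavy lines offers `R` almost open vertices. Hall's
theorem makes the second coordinates distinct too, which is what keeps the neighbourhoods almost
disjoint. -/
theorem exists_almostOpen_transversal {i θ R : ℕ} (hi : 2 ≤ i) (hR0 : 0 < R) (hR : R ≤ n)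
    {A : Set (Fin d → Fin n)}
    (hA : ∀ (v : Fin d → Fin n) (e : Fin d), {x | Function.update v e x ∈ A}.ncard + d * R ≤ n)
    (h : A ∈ someSubtorusOpen n d i θ) :
    ∃ (v : Fin d → Fin n) (e e' : Fin d) (z x : Fin R → Fin n), e ≠ e' ∧
      Function.Injective z ∧ Function.Injective x ∧ ∀ k,
        AlmostOpen θ A (d * (d * R)) (Function.update (Function.update v e' (z k)) e (x k)) := by
  classical
  have hex := exists_crowded hi hR hA h
  obtain ⟨v, e, e', hee, hcard⟩ := Nat.find_spec hex
  obtain ⟨Z, hZ, hZc⟩ := Set.exists_subset_card_eq hcard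
  obtain ⟨Z, rfl⟩ := Z.toFinite.exists_finset_coe
  rw [Set.ncard_coe_finset] at hZc
  let z : Fin R → Fin n := fun k => (Z.equivFinOfCardEq hZc).symm k
  have hz : Function.Injective z :=
    Subtype.val_injective.comp (Z.equivFinOfCardEq hZc).symm.injective
  have hlarge (k : Fin R) := le_ncard_almostOpen_of_heavy hR0 (fun r hr => Nat.find_min hex hr)
    (hZ ((Z.equivFinOfCardEq hZc).symm k).2)
  -- Hall's condition is immediate: a single line already has `R` candidates, and there are only `R`
  -- lines.
  obtain ⟨x, hx, hxm⟩ := (Finset.all_card_le_biUnion_card_iff_exists_injective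
    (fun k : Fin R => (Set.toFinite {x : Fin n | AlmostOpen θ A (d * (d * R))
      (Function.update (Function.update v e' (z k)) e x)}).toFinset)).1 (by
    intro s
    rcases s.eq_empty_or_nonempty with rfl | ⟨k, hk⟩
    · simp
    · refine le_trans ?_ (Finset.card_le_card (Finset.subset_biUnion_of_mem _ hk))
      rw [← Set.ncard_eq_toFinset_card]
      exact (Finset.card_le_univ s).trans (by simpa using hlarge k))
  exact ⟨v, e, e', z, x, hee, hz, hx, fun k => by simpa using hxm k⟩

/-- The neighbours of the `k`-th vertex of a family that are not adjacent to any other member. -/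
def privateNeighbors {κ : Type*} (w : κ → Fin d → Fin n) (k : κ) : Set (Fin d → Fin n) :=
  {y | (hammingTorus n d).Adj (w k) y ∧ ∀ l ≠ k, ¬ (hammingTorus n d).Adj (w l) y}

theorem disjoint_privateNeighbors {κ : Type*} (w : κ → Fin d → Fin n) :
    Pairwise (Function.onFun Disjoint (privateNeighbors w)) := by
  intro k l hkl
  refine Set.disjoint_left.2 fun y hy hy' => hy'.2 k hkl hy.1

/-- The two vertices are opposite corners of a rectangle; a common neighbour differs from each in
one coordinate, so it is one of the other two corners. -/
theorem commonNeighbors_subset {v : Fin d → Fin n} {e e' : Fin d} (hee : e ≠ e')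
    {z₁ z₂ x₁ x₂ : Fin n} (hz : z₁ ≠ z₂) (hx : x₁ ≠ x₂) {y : Fin d → Fin n}
    (h₁ : (hammingTorus n d).Adj (Function.update (Function.update v e' z₁) e x₁) y)
    (h₂ : (hammingTorus n d).Adj (Function.update (Function.update v e' z₂) e x₂) y) :
    y = Function.update (Function.update v e' z₁) e x₂ ∨
      y = Function.update (Function.update v e' z₂) e x₁ := by
  obtain ⟨a, s, -, rfl⟩ := exists_eq_update_of_adj h₁
  obtain ⟨b, t, -, hab⟩ := exists_eq_update_of_adj h₂
  have he := congrFun hab e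
  have he' := congrFun hab e'
  by_cases ha : a = e
  · subst ha
    left
    have hb : b = e' := by
      by_contra hb
      simp [hee.symm, Ne.symm hb, hz] at he'
    subst hb
    simp only [Function.update_self, Function.update_of_ne hee] at he
    simp [he]
  · have hb : b = e := by
      by_contra hb
      simp [Ne.symm ha, Ne.symm hb, hx] at he
    subst hb
    have ha' : a = e' := by
      by_contra ha'
      simp [hee.symm, Ne.symm ha', hz] at he'
    subst ha'
    right
    simp only [Function.update_self, Function.update_of_ne ha] at he'
    rw [he', Function.update_comm hee]
    simp

/-- Each other member of the family shares at most two neighbours with the `k`-th; the bound counts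
`l = k` as well, for simplicity. -/
theorem ncard_neighborSet_inter_le {κ : Type*} [Fintype κ] {v : Fin d → Fin n} {e e' : Fin d}
    (hee : e ≠ e') {z x : κ → Fin n} (hz : Function.Injective z) (hx : Function.Injective x)
    (A : Set (Fin d → Fin n)) (k : κ) :
    ((hammingTorus n d).neighborSet
        (Function.update (Function.update v e' (z k)) e (x k)) ∩ A).ncard ≤
      (privateNeighbors (fun l => Function.update (Function.update v e' (z l)) e (x l)) k
        ∩ A).ncard + 2 * Fintype.card κ := by
  classical
  set f : κ → Set (Fin d → Fin n) := fun l =>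
    {Function.update (Function.update v e' (z k)) e (x l),
      Function.update (Function.update v e' (z l)) e (x k)} with hf
  have hsub : (hammingTorus n d).neighborSet
        (Function.update (Function.update v e' (z k)) e (x k)) ∩ A ⊆
      (privateNeighbors (fun l => Function.update (Function.update v e' (z l)) e (x l)) k
        ∩ A) ∪ ⋃ l, f l := by
    rintro y ⟨hy, hyA⟩
    by_cases h : ∃ l ≠ k, (hammingTorus n d).Adj
        (Function.update (Function.update v e' (z l)) e (x l)) y
    · obtain ⟨l, hl, hadj⟩ := h
      exact Or.inr (Set.mem_iUnion.2 ⟨l, commonNeighbors_subset hee (hz.ne hl.symm)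
        (hx.ne hl.symm) hy hadj⟩)
    · push Not at h
      exact Or.inl ⟨⟨hy, h⟩, hyA⟩
  refine (Set.ncard_le_ncard hsub (Set.toFinite _)).trans ((Set.ncard_union_le _ _).trans ?_)
  refine Nat.add_le_add_left ((Set.ncard_iUnion_le_of_fintype _).trans ?_) _
  calc _ ≤ ∑ _l : κ, 2 := Finset.sum_le_sum fun l _ =>
        (Set.ncard_insert_le _ _).trans (by simp)
    _ = 2 * Fintype.card κ := by simp [mul_comm]

theorem ncard_privateNeighbors_le {κ : Type*} (w : κ → Fin d → Fin n) (k : κ) :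
    (privateNeighbors w k).ncard ≤ d * n := by
  have hsub : privateNeighbors w k ⊆ ⋃ e, Set.range (Function.update (w k) e) := by
    intro y hy
    obtain ⟨e, x, -, rfl⟩ := exists_eq_update_of_adj hy.1
    exact Set.mem_iUnion.2 ⟨e, x, rfl⟩
  refine (Set.ncard_le_ncard hsub (Set.toFinite _)).trans
    ((Set.ncard_iUnion_le_of_fintype _).trans ?_)
  calc _ ≤ ∑ _e : Fin d, n := Finset.sum_le_sum fun e _ => ?_
    _ = d * n := by simp
  rw [← Set.image_univ]
  exact (Set.ncard_image_le (Set.toFinite _)).trans (by simp)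

end NewlyOpen

/-! ### Lower bound: union bound over transversals. -/

section UnionBound

variable {n d : ℕ}

theorem prob_le_ncard_line (p : unitInterval) (v : Fin d → Fin n) (e : Fin d) (L : ℕ) :
    (bernoulliSubset (Fin d → Fin n) p).real
      {A | L ≤ {x | Function.update v e x ∈ A}.ncard} ≤ (n * p : ℝ) ^ L := by
  classical
  have h := bernoulliSubset_le_ncard_inter p (Finset.univ.image (Function.update v e)) L
  rw [Finset.card_image_of_injective _ (Function.update_injective v e)] at h
  simp only [Finset.card_univ, Fintype.card_fin] at h
  refine le_trans (measureReal_mono fun A hA => ?_) h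
  change L ≤ _ at hA
  refine hA.trans ?_
  rw [← Set.ncard_image_of_injective _ (Function.update_injective v e)]
  refine Set.ncard_le_ncard ?_ (Set.toFinite _)
  rintro _ ⟨x, hx, rfl⟩
  exact ⟨by simp, hx⟩

theorem determinedBy_le_ncard_inter {V : Type*} (T : Set V) (u : ℕ) :
    DeterminedBy {A | u ≤ (T ∩ A).ncard} T := by
  intro A B hAB hA
  have : T ∩ A = T ∩ B := by
    ext v
    exact and_congr_right fun hv => hAB v hv
  simpa [← this] using hA

theorem prob_forall_le_ncard_privateNeighbors {κ : Type*} [Fintype κ] (p : unitInterval)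
    (w : κ → Fin d → Fin n) (u : ℕ) :
    (bernoulliSubset (Fin d → Fin n) p).real
      (⋂ k ∈ (Finset.univ : Finset κ), {A | u ≤ (privateNeighbors w k ∩ A).ncard}) ≤
      ((d * n * p : ℝ) ^ u) ^ Fintype.card κ := by
  classical
  rw [bernoulliSubset_biInter p _ (fun k _ => determinedBy_le_ncard_inter _ u)
    (fun k _ l _ hkl => disjoint_privateNeighbors w hkl)]
  calc _ ≤ ∏ _k : κ, (d * n * p : ℝ) ^ u := Finset.prod_le_prod (fun k _ => measureReal_nonneg)
        fun k _ => ?_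
    _ = _ := by simp
  have hfin := Set.toFinite (privateNeighbors w k)
  have h := bernoulliSubset_le_ncard_inter p hfin.toFinset u
  rw [Set.Finite.coe_toFinset, ← Set.ncard_eq_toFinset_card] at h
  refine h.trans ?_
  have := p.2.1
  gcongr
  exact_mod_cast ncard_privateNeighbors_le w k

/-- The first term counts the transversals, the second the lines with `L` initially open vertices.
In `hu`, `d * (d * R)` is the help from newly open vertices and `2 * R` the loss from shared
neighbours. -/
theorem probSubtorusOpen_le {i θ R u L : ℕ} (hi : 2 ≤ i) (hR0 : 0 < R) (hR : R ≤ n)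
    (hL : L + d * R ≤ n) (hu : u + d * (d * R) + 2 * R ≤ θ) (p : unitInterval) :
    probSubtorusOpen n d i θ p ≤
      (n : ℝ) ^ d * d * d * n ^ R * n ^ R * ((d * n * p : ℝ) ^ u) ^ R +
        (n : ℝ) ^ d * d * (n * p : ℝ) ^ L := by
  classical
  let E : ((Fin d → Fin n) × Fin d × Fin d × (Fin R → Fin n) × (Fin R → Fin n)) →
      Set (Set (Fin d → Fin n)) := fun c =>
    ⋂ k ∈ (Finset.univ : Finset (Fin R)), {A | u ≤ (privateNeighbors (fun l =>
      Function.update (Function.update c.1 c.2.2.1 (c.2.2.2.1 l)) c.2.1 (c.2.2.2.2 l)) k ∩ A).ncard}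
  let F : ((Fin d → Fin n) × Fin d) → Set (Set (Fin d → Fin n)) := fun c =>
    {A | L ≤ {x | Function.update c.1 c.2 x ∈ A}.ncard}
  have hsub : someSubtorusOpen n d i θ ⊆ (⋃ c, E c) ∪ ⋃ c, F c := by
    intro A hA
    by_cases hF : ∃ v e, L ≤ {x | Function.update v e x ∈ A}.ncard
    · obtain ⟨v, e, h⟩ := hF
      exact Or.inr (Set.mem_iUnion.2 ⟨(v, e), h⟩)
    · push Not at hF
      obtain ⟨v, e, e', z, x, hee, hz, hx, h⟩ := exists_almostOpen_transversal hi hR0 hR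
        (fun v e => by have := hF v e; omega) hA
      refine Or.inl (Set.mem_iUnion.2 ⟨(v, e, e', z, x), ?_⟩)
      simp only [E, Set.mem_iInter]
      intro k _
      have h1 := h k
      have h2 := ncard_neighborSet_inter_le (v := v) hee hz hx A k
      rw [Fintype.card_fin] at h2
      rw [AlmostOpen] at h1
      change u ≤ _
      omega
  refine (measureReal_mono hsub).trans ((measureReal_union_le _ _).trans (add_le_add ?_ ?_))
  · refine (measureReal_iUnion_fintype_le _).trans ?_
    calc _ ≤ ∑ _c : (Fin d → Fin n) × Fin d × Fin d × (Fin R → Fin n) × (Fin R → Fin n),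
          ((d * n * p : ℝ) ^ u) ^ R := Finset.sum_le_sum fun c _ => by
            have := prob_forall_le_ncard_privateNeighbors p (fun l : Fin R =>
              Function.update (Function.update c.1 c.2.2.1 (c.2.2.2.1 l)) c.2.1 (c.2.2.2.2 l)) u
            rwa [Fintype.card_fin] at this
      _ = _ := by
          simp only [Finset.sum_const, Finset.card_univ, Fintype.card_prod, Fintype.card_pi,
            Fintype.card_fin, Finset.prod_const, nsmul_eq_mul]
          push_cast
          ring
  · refine (measureReal_iUnion_fintype_le _).trans ?_
    calc _ ≤ ∑ _c : (Fin d → Fin n) × Fin d, (n * p : ℝ) ^ L :=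
          Finset.sum_le_sum fun c _ => prob_le_ncard_line p c.1 c.2 L
      _ = _ := by simp

end UnionBound

/-! ### Lower bound: the exponent. -/

section LowerBound

theorem rpow_three_halves {x : ℝ} (hx : 0 < x) : x ^ (3 / 2 : ℝ) = x * √x := by
  rw [show (3 / 2 : ℝ) = 1 + 1 / 2 by norm_num, Real.rpow_add hx, Real.rpow_one,
    Real.sqrt_eq_rpow]

/-- The `2 * R` from the positions cancels `(2 / θ) * θ * R`. What remains is a loss `4 * d ^ 2 * R
^ 2 / θ`, at most `16 * d ^ 2` as `R ≤ 2 * √θ`, against a gain of at least `50 * d ^ 2` from the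
correction term. -/
theorem subcritical_exponent_le {d θ R u : ℝ} (hd : 1 ≤ d) (hθ : 64 * d ^ 4 ≤ θ)
    (hR : √θ ≤ R) (hR' : R ≤ √θ + 1) (hu : u = θ - 2 * d ^ 2 * R) :
    d + R + R - (2 / θ + 100 * d ^ 2 / (θ * √θ)) * (u * R) ≤ -1 := by
  have hθ0 : 0 < θ := lt_of_lt_of_le (by positivity) hθ
  set s := √θ with hs
  have hs2 : s ^ 2 = θ := Real.sq_sqrt hθ0.le
  have hs8 : 8 * d ^ 2 ≤ s := Real.le_sqrt_of_sq_le (by nlinarith)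
  have hs0 : 0 < s := lt_of_lt_of_le (by positivity) hs8
  have hd2 : 1 ≤ d ^ 2 := by nlinarith
  have hR2 : R ≤ 2 * s := by linarith
  have h1 : 2 / θ + 100 * d ^ 2 / (θ * s) = (2 + 100 * d ^ 2 / s) / s ^ 2 := by
    rw [hs2]; field_simp
  set r := R / s with hr
  have hRr : R = r * s := by rw [hr]; field_simp
  have hr1 : 1 ≤ r := by rw [hr, le_div_iff₀ hs0]; linarith
  have hr2 : r ≤ 2 := by rw [hr, div_le_iff₀ hs0]; linarith
  set δ := d ^ 2 / s with hδ
  have hδ0 : 0 ≤ δ := by positivity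
  have hδ8 : 8 * δ ≤ 1 := by rw [hδ, ← mul_div_assoc, div_le_one hs0]; linarith
  have hds : d ^ 2 = δ * s := by rw [hδ]; field_simp
  have h2 : (2 + 100 * d ^ 2 / s) / s ^ 2 * (u * R) =
      2 * R + 100 * d ^ 2 * r * (1 - 2 * δ * r) - 4 * d ^ 2 * r ^ 2 := by
    rw [hu, ← hs2, hRr, hds]
    field_simp
    ring
  rw [h1, h2]
  have h3 : 1 / 2 ≤ 1 - 2 * δ * r := by nlinarith
  have h4 : 1 / 2 ≤ r * (1 - 2 * δ * r) := by nlinarith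
  have h5 : 100 * d ^ 2 * (1 / 2) ≤ 100 * d ^ 2 * (r * (1 - 2 * δ * r)) := by gcongr
  have h6 : 4 * d ^ 2 * r ^ 2 ≤ 4 * d ^ 2 * 4 := by gcongr; nlinarith
  nlinarith

theorem probSubtorusOpen_lt_half {i d : ℕ} (hi : 2 ≤ i) (hd : 2 ≤ d) {θ : ℕ}
    (hθ : 64 * d ^ 4 ≤ θ) : ∃ N : ℕ, ∀ n : ℕ, N ≤ n → ∀ p : unitInterval,
      (p : ℝ) ≤ (n : ℝ) ^ (-1 - 2 / (θ : ℝ) - 100 * (d : ℝ) ^ 2 / (θ : ℝ) ^ (3 / 2 : ℝ)) →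
      probSubtorusOpen n d i θ p < 1 / 2 := by
  have hd0 : 0 < d := by omega
  have hθ0 : 0 < θ := lt_of_lt_of_le (by positivity) hθ
  have hθ0' : (0 : ℝ) < θ := by exact_mod_cast hθ0
  have hθR : 64 * (d : ℝ) ^ 4 ≤ θ := by exact_mod_cast hθ
  set R := ⌈√(θ : ℝ)⌉₊ with hRdef
  have hR1 : √(θ : ℝ) ≤ R := Nat.le_ceil _
  have hR2 : (R : ℝ) ≤ √θ + 1 := (Nat.ceil_lt_add_one (Real.sqrt_nonneg _)).le
  have hs0 : 0 < √(θ : ℝ) := Real.sqrt_pos.2 hθ0'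
  have hR0 : 0 < R := Nat.ceil_pos.2 hs0
  have hd1 : (1 : ℝ) ≤ d := by exact_mod_cast hd0
  have hRθ : 2 * d ^ 2 * R ≤ θ := by
    have h8 : 8 * (d : ℝ) ^ 2 ≤ √θ := Real.le_sqrt_of_sq_le (by nlinarith)
    have hss : √(θ : ℝ) * √θ = θ := Real.mul_self_sqrt hθ0'.le
    have h1 : (R : ℝ) ≤ 2 * √θ := by nlinarith
    have : (2 * d ^ 2 * R : ℝ) ≤ θ := by
      calc (2 * d ^ 2 * R : ℝ) ≤ 2 * d ^ 2 * (2 * √θ) := by gcongr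
        _ ≤ √θ * √θ := by nlinarith
        _ = θ := hss
    exact_mod_cast this
  set u := θ - 2 * d ^ 2 * R with hu
  have huR : (u : ℝ) = θ - 2 * (d : ℝ) ^ 2 * R := by
    rw [hu, Nat.cast_sub hRθ]; push_cast; ring
  have huθ : u + d * (d * R) + 2 * R ≤ θ := by
    have : 2 * R ≤ d ^ 2 * R := Nat.mul_le_mul_right _ (by nlinarith)
    have h2 : d * (d * R) = d ^ 2 * R := by ring
    have h3 : 2 * d ^ 2 * R = d ^ 2 * R + d ^ 2 * R := by ring
    omega
  set K : ℝ := d * d * (d : ℝ) ^ (u * R) + d with hK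
  have hK0 : 0 < K := by positivity
  -- The first entry is the condition `L + d * R ≤ n` for `L = d * θ`; the second makes the final
  -- bound `K / n` smaller than `1 / 2`.
  refine ⟨max (d * θ + d * R) (⌈2 * K⌉₊ + 1), fun n hn p hp => ?_⟩
  have hn1 : d * θ + d * R ≤ n := (le_max_left _ _).trans hn
  have hn2 : 2 * K < n := by
    have h1 : ⌈2 * K⌉₊ + 1 ≤ n := (le_max_right _ _).trans hn
    have h2 : (⌈2 * K⌉₊ : ℝ) + 1 ≤ n := by exact_mod_cast h1
    linarith [Nat.le_ceil (2 * K)]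
  have hRn : R ≤ n := by nlinarith
  have hn0 : (0 : ℝ) < n := by linarith
  have hn1' : (1 : ℝ) ≤ n := by
    have : 0 < n := by exact_mod_cast hn0
    exact_mod_cast this
  set a : ℝ := 2 / θ + 100 * (d : ℝ) ^ 2 / (θ * √θ) with ha
  have hp0 : (0 : ℝ) ≤ p := p.2.1
  have hnp : n * (p : ℝ) ≤ (n : ℝ) ^ (-a) := by
    calc n * (p : ℝ) ≤ n * (n : ℝ) ^ (-1 - 2 / (θ : ℝ) - 100 * (d : ℝ) ^ 2 /
          (θ : ℝ) ^ (3 / 2 : ℝ)) := by gcongr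
      _ = (n : ℝ) ^ (1 : ℝ) * (n : ℝ) ^ (-1 - 2 / (θ : ℝ) - 100 * (d : ℝ) ^ 2 /
          (θ : ℝ) ^ (3 / 2 : ℝ)) := by rw [Real.rpow_one]
      _ = (n : ℝ) ^ (-a) := by
          rw [← Real.rpow_add hn0, rpow_three_halves hθ0', ha]
          ring_nf
  have hpow (m : ℕ) : (n * (p : ℝ)) ^ m ≤ (n : ℝ) ^ (-a * m) := by
    rw [Real.rpow_mul hn0.le, Real.rpow_natCast]
    gcongr
  have hfirst : (n : ℝ) ^ d * d * d * n ^ R * n ^ R * ((d * n * p : ℝ) ^ u) ^ R ≤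
      d * d * (d : ℝ) ^ (u * R) * (n : ℝ) ^ (-1 : ℝ) := by
    calc (n : ℝ) ^ d * d * d * n ^ R * n ^ R * ((d * n * p : ℝ) ^ u) ^ R
        = d * d * (d : ℝ) ^ (u * R) * ((n : ℝ) ^ d * n ^ R * n ^ R * (n * p : ℝ) ^ (u * R)) := by
          rw [← pow_mul, mul_assoc (d : ℝ) n p, mul_pow]
          ring
      _ ≤ d * d * (d : ℝ) ^ (u * R) *
          ((n : ℝ) ^ d * n ^ R * n ^ R * (n : ℝ) ^ (-a * (u * R : ℕ))) := by
          gcongr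
          exact hpow _
      _ = d * d * (d : ℝ) ^ (u * R) * (n : ℝ) ^ (d + R + R - a * (u * R : ℝ)) := by
          rw [← Real.rpow_natCast (n : ℝ) d, ← Real.rpow_natCast (n : ℝ) R,
            ← Real.rpow_add hn0, ← Real.rpow_add hn0, ← Real.rpow_add hn0]
          push_cast
          ring_nf
      _ ≤ _ := by
          gcongr
          exact subcritical_exponent_le hd1 hθR hR1 hR2 huR
  -- With `L = d * θ` the power of `n * p` is at most `n ^ (-2 * d)`, enough to beat the `n ^ d`
  -- choices of a line.
  have hsecond : (n : ℝ) ^ d * d * (n * p : ℝ) ^ (d * θ) ≤ d * (n : ℝ) ^ (-1 : ℝ) := by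
    calc (n : ℝ) ^ d * d * (n * p : ℝ) ^ (d * θ)
        = d * ((n : ℝ) ^ d * (n * p : ℝ) ^ (d * θ)) := by ring
      _ ≤ d * ((n : ℝ) ^ (d : ℝ) * (n : ℝ) ^ (-a * (d * θ : ℕ))) := by
          rw [Real.rpow_natCast]
          gcongr
          exact hpow _
      _ = d * (n : ℝ) ^ (d + -a * (d * θ : ℕ)) := by rw [← Real.rpow_add hn0]
      _ ≤ _ := by
          gcongr
          have h1 : 2 / (θ : ℝ) ≤ a := by
            rw [ha]
            have : 0 ≤ 100 * (d : ℝ) ^ 2 / (θ * √θ) := by positivity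
            linarith
          have h2 : 2 / (θ : ℝ) * (d * θ : ℕ) ≤ a * (d * θ : ℕ) := by gcongr
          have h3 : 2 / (θ : ℝ) * (d * θ : ℕ) = 2 * d := by push_cast; field_simp
          linarith
  calc probSubtorusOpen n d i θ p ≤ _ := probSubtorusOpen_le hi hR0 hRn hn1 huθ p
    _ ≤ d * d * (d : ℝ) ^ (u * R) * (n : ℝ) ^ (-1 : ℝ) + d * (n : ℝ) ^ (-1 : ℝ) :=
        add_le_add hfirst hsecond
    _ = K / n := by rw [Real.rpow_neg_one, hK]; ring
    _ < 1 / 2 := by rw [div_lt_iff₀ hn0]; linarith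

end LowerBound

/-! ### Upper bound: deterministic filling of a plane. -/

section PlaneFilling

/-- A two-dimensional set of sites closed under the threshold rule is full as soon as it contains
`k` rows and `k` columns with `s ≥ θ / 2` open sites, and `θ` rows and `θ` columns with `s - k`
open sites. -/
theorem forall_of_strong_weak_lines {X Y : Type*} [DecidableEq X] [DecidableEq Y]
    {Q : X → Y → Prop} {θ s k : ℕ}
    (hQ : ∀ x y (R : Finset X) (C : Finset Y), (∀ x' ∈ R, Q x' y) → (∀ y' ∈ C, Q x y') →
      θ ≤ R.card + C.card → Q x y)
    (hs : θ ≤ 2 * s) {S W : Finset X} {S' W' : Finset Y} {C : Y → Finset X} {D : X → Finset Y}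
    (hS : k ≤ S.card) (hS' : k ≤ S'.card) (hW : θ ≤ W.card) (hW' : θ ≤ W'.card)
    (hC : ∀ y, ∀ x ∈ C y, Q x y) (hD : ∀ x, ∀ y ∈ D x, Q x y)
    (hCS : ∀ y, Disjoint (C y) S) (hDS : ∀ x, Disjoint (D x) S')
    (hCs : ∀ y ∈ S', s ≤ (C y).card) (hDs : ∀ x ∈ S, s ≤ (D x).card)
    (hCw : ∀ y ∈ W', s ≤ (C y).card + k) (hDw : ∀ x ∈ W, s ≤ (D x).card + k) (x : X) (y : Y) :
    Q x y := by
  -- Crossings of two strong lines see `s + s ≥ θ` open sites. The `k` sites thus opened on a strong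
  -- line make up for the deficit `k` of a weak line crossing it. After that each weak line has
  -- itself gained `k` sites, so crossings of two weak lines open too.
  have h1 : ∀ x ∈ S, ∀ y ∈ S', Q x y := fun x hx y hy =>
    hQ x y (C y) (D x) (hC y) (hD x) (by have := hCs y hy; have := hDs x hx; omega)
  have h2 : ∀ x ∈ S, ∀ y ∈ W', Q x y := fun x hx y hy =>
    hQ x y (C y) (D x ∪ S') (hC y)
      (fun y' hy' => (Finset.mem_union.1 hy').elim (hD x y') (h1 x hx y')) (by
        rw [Finset.card_union_of_disjoint (hDS x)]
        have := hCw y hy; have := hDs x hx; omega)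
  have h3 : ∀ x ∈ W, ∀ y ∈ S', Q x y := fun x hx y hy =>
    hQ x y (C y ∪ S) (D x)
      (fun x' hx' => (Finset.mem_union.1 hx').elim (hC y x') fun h => h1 x' h y hy) (hD x) (by
        rw [Finset.card_union_of_disjoint (hCS y)]
        have := hCs y hy; have := hDw x hx; omega)
  have h4 : ∀ x ∈ W, ∀ y ∈ W', Q x y := fun x hx y hy =>
    hQ x y (C y ∪ S) (D x ∪ S')
      (fun x' hx' => (Finset.mem_union.1 hx').elim (hC y x') fun h => h2 x' h y hy)
      (fun y' hy' => (Finset.mem_union.1 hy').elim (hD x y') (h3 x hx y')) (by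
        rw [Finset.card_union_of_disjoint (hCS y), Finset.card_union_of_disjoint (hDS x)]
        have := hCw y hy; have := hDw x hx; omega)
  -- A weak line now has `θ` open crossings and fills; then every perpendicular line meets `θ` full
  -- lines.
  have h5 : ∀ x, ∀ y ∈ W', Q x y := fun x y hy =>
    hQ x y W ∅ (fun x' hx' => h4 x' hx' y hy) (by simp) (by simpa using hW)
  exact hQ x y ∅ W' (by simp) (fun y' hy' => h5 x y' hy') (by simpa using hW')

end PlaneFilling

/-! ### Blocks of consecutive coordinates. -/

section Blocks

variable {n : ℕ}

/-- The `j`-th block of `g` consecutive elements of `Fin n`. -/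
def block (n g j : ℕ) : Finset (Fin n) := Finset.univ.filter fun x => (x : ℕ) / g = j

theorem mem_block {g j : ℕ} {x : Fin n} : x ∈ block n g j ↔ (x : ℕ) / g = j := by
  simp [block]

theorem disjoint_block {g i j : ℕ} (hij : i ≠ j) : Disjoint (block n g i) (block n g j) :=
  Finset.disjoint_left.2 fun _ hx hy => hij ((mem_block.1 hx).symm.trans (mem_block.1 hy))

theorem div_eq_iff_mul_le_lt {g j x : ℕ} (hg : 0 < g) :
    x / g = j ↔ j * g ≤ x ∧ x < (j + 1) * g := by
  rw [← Nat.le_div_iff_mul_le hg, ← Nat.div_lt_iff_lt_mul hg]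
  omega

theorem card_block {g j : ℕ} (hg : 0 < g) (hj : (j + 1) * g ≤ n) : (block n g j).card = g := by
  have h : (block n g j).map Fin.valEmbedding = Finset.Ico (j * g) ((j + 1) * g) := by
    ext x
    simp only [Finset.mem_map, mem_block, Fin.valEmbedding_apply, Finset.mem_Ico]
    constructor
    · rintro ⟨y, hy, rfl⟩
      exact (div_eq_iff_mul_le_lt hg).1 hy
    · intro hx
      exact ⟨⟨x, hx.2.trans_le hj⟩, (div_eq_iff_mul_le_lt hg).2 hx, rfl⟩
  rw [← Finset.card_map Fin.valEmbedding, h, Nat.card_Ico, Nat.succ_mul, Nat.add_sub_cancel_left]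

/-- One representative per block; disjointness makes them distinct, and the block index is recovered
as `x / g`. -/
theorem exists_finset_of_blocks {g : ℕ} {J : Finset ℕ} {P : ℕ → Fin n → Prop}
    (h : ∀ j ∈ J, ∃ x ∈ block n g j, P j x) :
    ∃ S : Finset (Fin n), S.card = J.card ∧ ∀ x ∈ S, (x : ℕ) / g ∈ J ∧ P ((x : ℕ) / g) x := by
  classical
  choose f hf using h
  refine ⟨J.attach.image (fun j : {x // x ∈ J} => f j.1 j.2), ?_, fun x hx => ?_⟩
  · rw [Finset.card_image_of_injective, Finset.card_attach]
    rintro ⟨i, hi⟩ ⟨j, hj⟩ hij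
    have hij : f i hi = f j hj := hij
    rw [Subtype.mk_eq_mk, ← mem_block.1 (hf i hi).1, ← mem_block.1 (hf j hj).1, hij]
  · obtain ⟨⟨j, hj⟩, -, rfl⟩ := Finset.mem_image.1 hx
    rw [mem_block.1 (hf j hj).1]
    exact ⟨hj, (hf j hj).2⟩

end Blocks

/-! ### Upper bound: line, plane and stack events, their probabilities and consequences. -/

section Events

variable {n d : ℕ}

/-- The line in direction `e` through `v` has an open vertex in each of the `m` blocks
with index at least `2 * θ`. -/
def lineEvent (θ g : ℕ) (e : Fin d) (v : Fin d → Fin n) (m : ℕ) : Set (Set (Fin d → Fin n)) :=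
  ⋂ j ∈ Finset.Ico (2 * θ) (2 * θ + m), ⋃ x ∈ block n g j, {A | Function.update v e x ∈ A}

/-- In the plane through `a` in directions `e`, `e'`, there are `θ` weak and `k` strong lines in
direction `e`. -/
def linesEvent (θ g s k : ℕ) (e e' : Fin d) (a : Fin d → Fin n) : Set (Set (Fin d → Fin n)) :=
  ⋂ j ∈ Finset.range (θ + k), ⋃ y ∈ block n g j,
    lineEvent θ g e (Function.update a e' y) (if j < θ then s - k else s)

/-- The plane through `a` in directions `e`, `e'` has enough strong and weak lines in both
directions. -/
def planeEvent (θ g s k : ℕ) (e e' : Fin d) (a : Fin d → Fin n) : Set (Set (Fin d → Fin n)) :=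
  linesEvent θ g s k e e' a ∩ linesEvent θ g s k e' e a

/-- Among the planes in directions `e`, `e'` met by the line through `a` in direction `f`, there is
one satisfying `planeEvent` in each of the first `θ` blocks. -/
def stackEvent (θ g s k : ℕ) (e e' f : Fin d) (a : Fin d → Fin n) : Set (Set (Fin d → Fin n)) :=
  ⋂ j ∈ Finset.range θ, ⋃ z ∈ block n g j, planeEvent θ g s k e e' (Function.update a f z)

/-- The vertices of the line through `v` in direction `e` in the blocks from `2 * θ` on. -/
def lineSupport (θ g : ℕ) (e : Fin d) (v : Fin d → Fin n) : Set (Fin d → Fin n) :=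
  {w | (∀ j, j ≠ e → w j = v j) ∧ 2 * θ ≤ (w e : ℕ) / g}

/-- The vertices of a plane that determine `linesEvent`. -/
def linesSupport (θ g : ℕ) (e e' : Fin d) (a : Fin d → Fin n) : Set (Fin d → Fin n) :=
  {w | (∀ j, j ≠ e → j ≠ e' → w j = a j) ∧ (w e' : ℕ) / g < 2 * θ ∧ 2 * θ ≤ (w e : ℕ) / g}

/-- The plane through `a` in directions `e`, `e'`. -/
def plane (e e' : Fin d) (a : Fin d → Fin n) : Set (Fin d → Fin n) :=
  {w | ∀ j, j ≠ e → j ≠ e' → w j = a j}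

theorem determinedBy_lineEvent (θ g : ℕ) (e : Fin d) (v : Fin d → Fin n) (m : ℕ) :
    DeterminedBy (lineEvent θ g e v m) (lineSupport θ g e v) := by
  refine (DeterminedBy.biInter _ fun j _ => DeterminedBy.biUnion (block n g j)
    fun x _ => determinedBy_mem (Function.update v e x)).mono ?_
  simp only [Set.iUnion_subset_iff, Set.singleton_subset_iff]
  intro j hj x hx
  refine ⟨fun i hi => Function.update_of_ne hi _ _, ?_⟩
  rw [Function.update_self, mem_block.1 hx]
  exact (Finset.mem_Ico.1 hj).1

theorem determinedBy_linesEvent {θ k : ℕ} (hk : k ≤ θ) (g s : ℕ) {e e' : Fin d} (hee : e ≠ e')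
    (a : Fin d → Fin n) :
    DeterminedBy (linesEvent θ g s k e e' a) (linesSupport θ g e e' a) := by
  refine (DeterminedBy.biInter _ fun j _ => DeterminedBy.biUnion (block n g j)
    fun y _ => determinedBy_lineEvent θ g e (Function.update a e' y) _).mono ?_
  simp only [Set.iUnion_subset_iff]
  rintro j hj y hy w ⟨hw, hwe⟩
  refine ⟨fun i hi hi' => by rw [hw i hi, Function.update_of_ne hi'], ?_, hwe⟩
  rw [hw e' hee.symm, Function.update_self, mem_block.1 hy]
  have := Finset.mem_range.1 hj
  omega

theorem determinedBy_planeEvent {θ k : ℕ} (hk : k ≤ θ) (g s : ℕ) {e e' : Fin d} (hee : e ≠ e')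
    (a : Fin d → Fin n) :
    DeterminedBy (planeEvent θ g s k e e' a) (plane e e' a) := by
  refine ((determinedBy_linesEvent hk g s hee a).inter
    (determinedBy_linesEvent hk g s hee.symm a)).mono ?_
  rintro w (hw | hw)
  · exact hw.1
  · exact fun j hj hj' => hw.1 j hj' hj

theorem le_prob_lineEvent {θ g m : ℕ} (hg : 0 < g) (hm : m ≤ θ) (hn : 3 * θ * g ≤ n)
    (p : unitInterval) (e : Fin d) (v : Fin d → Fin n) :
    (g * p / (1 + g * p) : ℝ) ^ m ≤
      (bernoulliSubset (Fin d → Fin n) p).real (lineEvent θ g e v m) := by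
  have h := bernoulliSubset_blocks p (Finset.Ico (2 * θ) (2 * θ + m)) (block n g)
    (fun i _ j _ hij => disjoint_block hij)
    (E := fun _ x => {A : Set (Fin d → Fin n) | Function.update v e x ∈ A})
    (T := fun x => {Function.update v e x}) (fun j _ x _ => determinedBy_mem _)
    (fun x y hxy => by
      simpa [Function.onFun] using fun h => hxy (Function.update_injective v e h))
    (fun _ => (p : ℝ)) (fun _ => p.2.1) (fun j _ x _ => (bernoulliSubset_mem p _).ge)
  refine le_trans (le_of_eq ?_) h
  rw [Finset.prod_congr rfl (g := fun _ => (g * p / (1 + g * p) : ℝ)) fun j hj => ?_]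
  · simp [div_pow]
  · rw [card_block hg (le_trans (Nat.mul_le_mul_right _ ?_) hn)]
    have := (Finset.mem_Ico.1 hj).2
    omega

theorem le_prob_linesEvent {θ g s k : ℕ} (hg : 0 < g) (hs : s ≤ θ) (hk : k ≤ θ)
    (hn : 3 * θ * g ≤ n) (p : unitInterval) {e e' : Fin d} (hee : e ≠ e') (a : Fin d → Fin n)
    {t : ℝ} (ht : t = g * p / (1 + g * p)) :
    (g * t ^ (s - k) / (1 + g * t ^ (s - k))) ^ θ * (g * t ^ s / (1 + g * t ^ s)) ^ k ≤
      (bernoulliSubset (Fin d → Fin n) p).real (linesEvent θ g s k e e' a) := by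
  have hp := p.2.1
  have ht0 : 0 ≤ t := by rw [ht]; positivity
  have h := bernoulliSubset_blocks p (Finset.range (θ + k)) (block n g)
    (fun i _ j _ hij => disjoint_block hij)
    (E := fun j y => lineEvent θ g e (Function.update a e' y) (if j < θ then s - k else s))
    (T := fun y => lineSupport θ g e (Function.update a e' y))
    (fun j _ y _ => determinedBy_lineEvent _ _ _ _ _)
    (fun y z hyz => Set.disjoint_left.2 fun w hw hw' => hyz (by
      have h1 := hw.1 e' hee.symm
      have h2 := hw'.1 e' hee.symm
      rw [Function.update_self] at h1 h2
      exact h1.symm.trans h2))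
    (fun j => t ^ (if j < θ then s - k else s)) (fun j => by positivity)
    (fun j _ y _ => by
      rw [ht]
      exact le_prob_lineEvent hg (by split_ifs <;> omega) hn p e _)
  refine le_trans (le_of_eq ?_) h
  rw [Finset.prod_congr rfl (g := fun j => (g * t ^ (if j < θ then s - k else s) /
    (1 + g * t ^ (if j < θ then s - k else s)) : ℝ)) fun j hj => ?_]
  · rw [Finset.prod_range_add]
    congr 1
    · rw [Finset.prod_congr rfl (g := fun _ => g * t ^ (s - k) / (1 + g * t ^ (s - k)))
        fun j hj => by rw [if_pos (Finset.mem_range.1 hj)]]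
      simp [div_pow]
    · simp [div_pow]
  · rw [card_block hg (le_trans (Nat.mul_le_mul_right _ ?_) hn)]
    have := Finset.mem_range.1 hj
    omega

theorem le_prob_planeEvent {θ g s k : ℕ} (hg : 0 < g) (hs : s ≤ θ) (hk : k ≤ θ)
    (hn : 3 * θ * g ≤ n) (p : unitInterval) {e e' : Fin d} (hee : e ≠ e') (a : Fin d → Fin n)
    {t : ℝ} (ht : t = g * p / (1 + g * p)) :
    ((g * t ^ (s - k) / (1 + g * t ^ (s - k))) ^ θ * (g * t ^ s / (1 + g * t ^ s)) ^ k) ^ 2 ≤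
      (bernoulliSubset (Fin d → Fin n) p).real (planeEvent θ g s k e e' a) := by
  have hp := p.2.1
  have ht0 : 0 ≤ t := by rw [ht]; positivity
  rw [planeEvent, bernoulliSubset_inter p (determinedBy_linesEvent hk g s hee a)
    (determinedBy_linesEvent hk g s hee.symm a), sq]
  · gcongr
    · exact le_prob_linesEvent hg hs hk hn p hee a ht
    · exact le_prob_linesEvent hg hs hk hn p hee.symm a ht
  -- The two directions are independent: the first event looks only at vertices whose
  -- `e'`-coordinate is in a block below `2 * θ`, the second only at those where it is not.
  · exact Set.disjoint_left.2 fun w hw hw' => absurd hw.2.1 (not_lt.2 hw'.2.2)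

/-- Distinct values of the `f`-coordinate give disjoint, hence independent, planes; each of the `θ`
blocks fails with probability at most `(1 - q) ^ g`. -/
theorem prob_compl_stackEvent_le {θ g s k : ℕ} (hg : 0 < g) (hs : s ≤ θ) (hk : k ≤ θ)
    (hn : 3 * θ * g ≤ n) (p : unitInterval) {e e' f : Fin d} (hee : e ≠ e') (hef : f ≠ e)
    (hef' : f ≠ e') (a : Fin d → Fin n) {t q : ℝ} (ht : t = g * p / (1 + g * p))
    (hq : q ≤ ((g * t ^ (s - k) / (1 + g * t ^ (s - k))) ^ θ *
      (g * t ^ s / (1 + g * t ^ s)) ^ k) ^ 2) :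
    (bernoulliSubset (Fin d → Fin n) p).real (stackEvent θ g s k e e' f a)ᶜ ≤
      θ * (1 - q) ^ g := by
  rw [stackEvent, Set.compl_iInter₂]
  refine (measureReal_biUnion_finset_le _ _).trans ?_
  calc _ ≤ ∑ _j ∈ Finset.range θ, (1 - q) ^ g := Finset.sum_le_sum fun j hj => ?_
    _ = _ := by simp
  rw [probReal_compl_eq_one_sub .of_discrete]
  have h := bernoulliSubset_exists_ge p (block n g j)
    (E := fun z => planeEvent θ g s k e e' (Function.update a f z))
    (T := fun z => plane e e' (Function.update a f z))
    (fun z _ => determinedBy_planeEvent hk g s hee _)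
    (fun z _ z' _ hzz => Set.disjoint_left.2 fun w hw hw' => hzz (by
      have h1 := hw f hef hef'
      have h2 := hw' f hef hef'
      rw [Function.update_self] at h1 h2
      exact h1.symm.trans h2))
    (x := q) (fun z _ => hq.trans (le_prob_planeEvent hg hs hk hn p hee _ ht))
  rw [card_block hg (le_trans (Nat.mul_le_mul_right _ (by
    have := Finset.mem_range.1 hj
    omega)) hn)] at h
  linarith

theorem exists_lines_of_linesEvent {θ g s k : ℕ} {e e' : Fin d} {a : Fin d → Fin n}
    {A : Set (Fin d → Fin n)} (h : A ∈ linesEvent θ g s k e e' a) :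
    ∃ S W : Finset (Fin n), S.card = k ∧ W.card = θ ∧ (∀ y ∈ S, (y : ℕ) / g < θ + k) ∧
      (∀ y ∈ S, A ∈ lineEvent θ g e (Function.update a e' y) s) ∧
      ∀ y ∈ W, A ∈ lineEvent θ g e (Function.update a e' y) (s - k) := by
  simp only [linesEvent, Set.mem_iInter, Set.mem_iUnion, exists_prop, Finset.mem_range] at h
  obtain ⟨S, hSc, hS⟩ := exists_finset_of_blocks (g := g) (J := Finset.Ico θ (θ + k))
    (P := fun j y => A ∈ lineEvent θ g e (Function.update a e' y) s)
    (fun j hj => by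
      obtain ⟨h1, h2⟩ := Finset.mem_Ico.1 hj
      simpa [not_lt.2 h1] using h j h2)
  obtain ⟨W, hWc, hW⟩ := exists_finset_of_blocks (g := g) (J := Finset.range θ)
    (P := fun j y => A ∈ lineEvent θ g e (Function.update a e' y) (s - k))
    (fun j hj => by
      have h1 := Finset.mem_range.1 hj
      simpa [h1] using h j (by omega))
  exact ⟨S, W, by simpa using hSc, by simpa using hWc,
    fun y hy => (Finset.mem_Ico.1 (hS y hy).1).2, fun y hy => (hS y hy).2, fun y hy => (hW y hy).2⟩

theorem le_card_of_lineEvent {θ g m : ℕ} {e : Fin d} {v : Fin d → Fin n}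
    {A : Set (Fin d → Fin n)} [DecidablePred fun x : Fin n =>
      2 * θ ≤ (x : ℕ) / g ∧ Function.update v e x ∈ A] (h : A ∈ lineEvent θ g e v m) :
    m ≤ (Finset.univ.filter fun x : Fin n =>
      2 * θ ≤ (x : ℕ) / g ∧ Function.update v e x ∈ A).card := by
  simp only [lineEvent, Set.mem_iInter, Set.mem_iUnion, exists_prop] at h
  obtain ⟨S, hSc, hS⟩ := exists_finset_of_blocks (g := g)
    (J := Finset.Ico (2 * θ) (2 * θ + m)) (P := fun _ x => Function.update v e x ∈ A) h
  rw [Nat.card_Ico, Nat.add_sub_cancel_left] at hSc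
  rw [← hSc]
  refine Finset.card_le_card fun x hx => ?_
  simp only [Finset.mem_filter, Finset.mem_univ, true_and]
  exact ⟨(Finset.mem_Ico.1 (hS x hx).1).1, (hS x hx).2⟩

/-- The event depends on `a` only through its plane, so this opens the entire plane. Strong lines
are indexed in blocks below `2 * θ` and the open vertices on lines lie in blocks from `2 * θ` on,
which gives the disjointness required by `forall_of_strong_weak_lines`. -/
theorem mem_finalOpen_of_planeEvent {θ g s k : ℕ} (hs : θ ≤ 2 * s) (hk : k ≤ θ) {e e' : Fin d}
    (hee : e ≠ e') {a : Fin d → Fin n} {A : Set (Fin d → Fin n)}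
    (h : A ∈ planeEvent θ g s k e e' a) :
    a ∈ finalOpen (hammingTorus n d) θ A := by
  classical
  obtain ⟨S', W', hSc', hWc', hSg', hS', hW'⟩ := exists_lines_of_linesEvent h.1
  obtain ⟨S, W, hSc, hWc, hSg, hS, hW⟩ := exists_lines_of_linesEvent h.2
  have hcomm (x y : Fin n) : Function.update (Function.update a e x) e' y =
      Function.update (Function.update a e' y) e x := Function.update_comm hee _ _ _
  have key := forall_of_strong_weak_lines (θ := θ) (s := s) (k := k)
    (Q := fun x y => Function.update (Function.update a e' y) e x ∈
      finalOpen (hammingTorus n d) θ A)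
    (fun x y R C hR hC hcard => by
      by_cases hxR : x ∈ R
      · exact hR x hxR
      by_cases hyC : y ∈ C
      · exact hC y hyC
      refine mem_finalOpen_of_le_card
        (S := R.image (fun x' => Function.update (Function.update a e' y) e x') ∪
          C.image (fun y' => Function.update (Function.update a e' y') e x)) ?_ ?_ ?_
      · intro w hw
        simp only [Finset.coe_union, Finset.coe_image, Set.mem_union, Set.mem_image,
          Finset.mem_coe] at hw
        rcases hw with ⟨x', hx', rfl⟩ | ⟨y', hy', rfl⟩
        · exact hR x' hx'
        · exact hC y' hy'
      · intro w hw
        rw [Finset.mem_union, Finset.mem_image, Finset.mem_image] at hw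
        right
        rcases hw with ⟨x', hx', rfl⟩ | ⟨y', hy', rfl⟩
        · have := adj_update (v := Function.update (Function.update a e' y) e x) (e := e)
            (x := x') (by rw [Function.update_self]; rintro rfl; exact hxR hx')
          simpa using this
        · have := adj_update (v := Function.update (Function.update a e x) e' y) (e := e')
            (x := y') (by rw [Function.update_self]; rintro rfl; exact hyC hy')
          rwa [Function.update_idem, hcomm, hcomm] at this
      · rw [Finset.card_union_of_disjoint, Finset.card_image_of_injective _
          (Function.update_injective _ e), Finset.card_image_of_injective]
        · exact hcard
        · intro y₁ y₂ hy
          simp only [← hcomm] at hy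
          exact Function.update_injective _ e' hy
        · rw [Finset.disjoint_left]
          intro w hw hw'
          obtain ⟨x', hx', rfl⟩ := Finset.mem_image.1 hw
          obtain ⟨y', hy', hy⟩ := Finset.mem_image.1 hw'
          have := congrFun hy e
          simp only [Function.update_self] at this
          exact hxR (this ▸ hx'))
    hs (S := S) (W := W) (S' := S') (W' := W')
    (C := fun y => Finset.univ.filter fun x : Fin n =>
      2 * θ ≤ (x : ℕ) / g ∧ Function.update (Function.update a e' y) e x ∈ A)
    (D := fun x => Finset.univ.filter fun y : Fin n =>
      2 * θ ≤ (y : ℕ) / g ∧ Function.update (Function.update a e x) e' y ∈ A)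
    hSc.ge hSc'.ge hWc.ge hWc'.ge
    (fun y x hx => subset_finalOpen (Finset.mem_filter.1 hx).2.2)
    (fun x y hy => subset_finalOpen (by rw [← hcomm]; exact (Finset.mem_filter.1 hy).2.2))
    (fun y => Finset.disjoint_left.2 fun x hx hx' => by
      have := (Finset.mem_filter.1 hx).2.1
      have := hSg x hx'
      omega)
    (fun x => Finset.disjoint_left.2 fun y hy hy' => by
      have := (Finset.mem_filter.1 hy).2.1
      have := hSg' y hy'
      omega)
    (fun y hy => le_card_of_lineEvent (hS' y hy))
    (fun x hx => le_card_of_lineEvent (hS x hx))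
    (fun y hy => by have := le_card_of_lineEvent (hW' y hy); omega)
    (fun x hx => by have := le_card_of_lineEvent (hW x hx); omega)
    (a e) (a e')
  simpa using key

theorem mem_finalOpen_of_stackEvent {θ g s k : ℕ} (hs : θ ≤ 2 * s) (hk : k ≤ θ) {e e' f : Fin d}
    (hee : e ≠ e') {a : Fin d → Fin n} {A : Set (Fin d → Fin n)}
    (h : A ∈ stackEvent θ g s k e e' f a) : a ∈ finalOpen (hammingTorus n d) θ A := by
  classical
  simp only [stackEvent, Set.mem_iInter, Set.mem_iUnion, exists_prop] at h
  obtain ⟨Z, hZc, hZ⟩ := exists_finset_of_blocks (g := g) (J := Finset.range θ)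
    (P := fun _ z => A ∈ planeEvent θ g s k e e' (Function.update a f z)) h
  refine mem_finalOpen_of_le_card (S := Z.image (Function.update a f)) ?_ ?_ ?_
  · intro w hw
    obtain ⟨z, hz, rfl⟩ := Finset.mem_image.1 (Finset.mem_coe.1 hw)
    exact mem_finalOpen_of_planeEvent hs hk hee (hZ z hz).2
  · intro w hw
    obtain ⟨z, hz, rfl⟩ := Finset.mem_image.1 hw
    by_cases hza : z = a f
    · left; rw [hza, Function.update_eq_self]
    · exact Or.inr (adj_update hza)
  · rw [Finset.card_image_of_injective _ (Function.update_injective _ _), hZc,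
      Finset.card_range]

/-- Union bound over all `n ^ d` vertices: if every stack event holds, the whole torus opens,
whatever `i` is. The third direction `f` is where `3 ≤ d` enters. -/
theorem one_sub_le_probSubtorusOpen {i θ g s k : ℕ} (hid : i ≤ d) (hd : 3 ≤ d) (hg : 0 < g)
    (hθs : θ ≤ 2 * s) (hs : s ≤ θ) (hk : k ≤ θ) (hn : 3 * θ * g ≤ n) (hn0 : 0 < n)
    (p : unitInterval) {t q : ℝ} (ht : t = g * p / (1 + g * p))
    (hq : q ≤ ((g * t ^ (s - k) / (1 + g * t ^ (s - k))) ^ θ *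
      (g * t ^ s / (1 + g * t ^ s)) ^ k) ^ 2) :
    1 - (n : ℝ) ^ d * (θ * (1 - q) ^ g) ≤ probSubtorusOpen n d i θ p := by
  let e : Fin d := ⟨0, by omega⟩
  let e' : Fin d := ⟨1, by omega⟩
  let f : Fin d := ⟨2, by omega⟩
  have hee : e ≠ e' := by simp [e, e']
  have hsub : (someSubtorusOpen n d i θ)ᶜ ⊆ ⋃ a, (stackEvent θ g s k e e' f a)ᶜ := by
    intro A hA
    by_contra hno
    simp only [Set.mem_iUnion, Set.mem_compl_iff, not_exists, not_not] at hno
    exact hA (mem_someSubtorusOpen_of_finalOpen_eq_univ hid hn0 (Set.eq_univ_of_forall fun a =>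
      mem_finalOpen_of_stackEvent hθs hk hee (hno a)))
  have h1 : (bernoulliSubset (Fin d → Fin n) p).real (someSubtorusOpen n d i θ)ᶜ ≤
      (n : ℝ) ^ d * (θ * (1 - q) ^ g) := by
    refine (measureReal_mono hsub).trans ((measureReal_iUnion_fintype_le _).trans ?_)
    calc _ ≤ ∑ _a : Fin d → Fin n, (θ * (1 - q) ^ g : ℝ) := Finset.sum_le_sum fun a _ =>
          prob_compl_stackEvent_le hg hs hk hn p hee (by simp [e, f]) (by simp [e', f]) a ht hq
      _ = _ := by simp
  rw [probReal_compl_eq_one_sub .of_discrete] at h1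
  change _ ≤ (bernoulliSubset (Fin d → Fin n) p).real (someSubtorusOpen n d i θ)
  linarith

end Events

/-! ### Upper bound: exponents and asymptotics. -/

section UpperBound

open Filter Topology

/-- With `s` about `θ / 2` and `k` about `√θ`, strong lines are just slightly too rare, and weak
lines are abundant. -/
theorem supercritical_exponents {θ s k b : ℝ} (hθ : 256 ≤ θ) (hs : θ ≤ 2 * s)
    (hs' : 2 * s ≤ θ + 1) (hk : √θ - 1 ≤ k) (hk' : k ≤ √θ)
    (hb : b = 2 / θ + 1 / 16 / (θ * √θ)) :
    0 ≤ b * s - 1 ∧ 2 * k * (b * s - 1) ≤ 1 / 4 ∧ b * (s - k) < 1 := by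
  have hθ0 : 0 < θ := by linarith
  set r := √θ with hr
  have hr2 : r ^ 2 = θ := Real.sq_sqrt hθ0.le
  have hr16 : 16 ≤ r := Real.le_sqrt_of_sq_le (by linarith)
  have hr0 : 0 < r := by linarith
  have hb' : b * r ^ 3 = 2 * r + 1 / 16 := by
    rw [hb, ← hr2]; field_simp
  have hb0 : 0 < b := by rw [hb]; positivity
  have hbθ : 2 ≤ b * θ := by
    have : b * θ * r = 2 * r + 1 / 16 := by rw [← hb', ← hr2]; ring
    nlinarith
  -- The `+ 1` comes from rounding `θ / 2` up to `s`; its cost of about `2 / r ^ 2` is absorbed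
  -- because `16 ≤ r`.
  have hbr : b * (r ^ 2 + 1) ≤ 2 + 1 / (4 * r) := by
    have h1 : b * (r ^ 2 + 1) = (2 * r + 1 / 16) * (r ^ 2 + 1) / r ^ 3 := by
      rw [← hb']; field_simp
    rw [h1, div_le_iff₀ (by positivity)]
    have h2 : (2 + 1 / (4 * r)) * r ^ 3 = 2 * r ^ 3 + r ^ 2 / 4 := by field_simp
    rw [h2]
    nlinarith
  have hbs : b * s - 1 ≤ 1 / (8 * r) := by
    have h1 : b * (2 * s) ≤ b * (r ^ 2 + 1) := by rw [hr2]; gcongr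
    have h2 : 1 / (4 * r) = 2 * (1 / (8 * r)) := by field_simp; norm_num
    linarith
  have h0 : 0 ≤ b * s - 1 := by nlinarith
  refine ⟨h0, ?_, ?_⟩
  · calc 2 * k * (b * s - 1) ≤ 2 * r * (1 / (8 * r)) := by gcongr
      _ = 1 / 4 := by field_simp; norm_num
  · have h1 : 1 / (8 * r) < b * k := by
      have h2 : b * (r - 1) ≤ b * k := by gcongr
      refine lt_of_lt_of_le ?_ h2
      rw [div_lt_iff₀ (by positivity)]
      have h3 : 2 * (r - 1) ≤ b * (r - 1) * r ^ 2 := by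
        rw [hr2]; nlinarith
      nlinarith
    nlinarith

theorem eventually_pow_mul_exp_lt {K c : ℝ} (hK : 0 < K) (hc : 0 < c) (d : ℕ) :
    ∀ᶠ n : ℕ in atTop, (n : ℝ) ^ d * Real.exp (-(K * (n : ℝ) ^ (3 / 4 : ℝ))) < c := by
  have h1 : Tendsto (fun n : ℕ => K * (n : ℝ) ^ (3 / 4 : ℝ)) atTop atTop :=
    ((tendsto_rpow_atTop (by norm_num)).comp tendsto_natCast_atTop_atTop).const_mul_atTop hK
  -- The power `2 * d` suffices since `(n ^ (3/4)) ^ (2 * d) = n ^ (3 * d / 2)` dominates `n ^ d`.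
  have h2 := (Real.tendsto_pow_mul_exp_neg_atTop_nhds_zero (2 * d)).comp h1
  have h3 := h2.eventually (gt_mem_nhds (show 0 < K ^ (2 * d) * c by positivity))
  filter_upwards [h3, eventually_ge_atTop 1] with n hn hn1
  have hn1' : (1 : ℝ) ≤ n := by exact_mod_cast hn1
  simp only [Function.comp_apply] at hn
  rw [mul_pow, mul_assoc] at hn
  have hn := lt_of_mul_lt_mul_left hn (by positivity)
  refine lt_of_le_of_lt ?_ hn
  gcongr
  rw [← Real.rpow_natCast, ← Real.rpow_natCast, ← Real.rpow_mul (by positivity)]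
  refine Real.rpow_le_rpow_of_exponent_le hn1' ?_
  push_cast
  have : (0 : ℝ) ≤ d := by positivity
  linarith

theorem half_le_div_one_add {x y : ℝ} (hy0 : 0 ≤ y) (hy1 : y ≤ 1) (hxy : y ≤ x) :
    y / 2 ≤ x / (1 + x) := by
  rw [div_le_div_iff₀ (by norm_num) (by linarith)]
  nlinarith

theorem le_blockDensity {x θ g p b : ℝ} (hx : 1 ≤ x) (hθ : 1 ≤ θ) (hb : 0 ≤ b)
    (hg : x / (6 * θ) ≤ g) (hp : 0 ≤ p) (hxp : x * p = x ^ (-b)) :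
    1 / (12 * θ) * x ^ (-b) ≤ g * p / (1 + g * p) := by
  have h1 : x * p / (6 * θ) ≤ g * p := by
    calc x * p / (6 * θ) = x / (6 * θ) * p := by ring
      _ ≤ g * p := by gcongr
  have h2 : x * p ≤ 1 := by
    rw [hxp]; exact Real.rpow_le_one_of_one_le_of_nonpos hx (by linarith)
  have h3 : x * p / (6 * θ) ≤ 1 := by
    rw [div_le_one (by positivity)]; linarith
  refine le_trans (le_of_eq ?_) (half_le_div_one_add (by positivity) h3 h1)
  rw [← hxp]
  field_simp
  ring

theorem le_mul_pow {x θ g t b κ : ℝ} (hx : 0 < x) (hθ : 0 < θ) (hκ : 0 ≤ κ)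
    (hg : x / (6 * θ) ≤ g) (ht : κ * x ^ (-b) ≤ t) (m : ℕ) :
    κ ^ m / (6 * θ) * x ^ (1 - b * m) ≤ g * t ^ m := by
  calc κ ^ m / (6 * θ) * x ^ (1 - b * m) = x / (6 * θ) * (κ * x ^ (-b)) ^ m := by
        rw [mul_pow, ← Real.rpow_natCast (x ^ (-b)), ← Real.rpow_mul hx.le,
          sub_eq_add_neg, Real.rpow_add hx, Real.rpow_one]
        ring_nf
    _ ≤ g * t ^ m := by
        have : 0 ≤ g := le_trans (by positivity) hg
        gcongr

theorem eventually_half_lt_probSubtorusOpen {i d θ : ℕ} (hid : i ≤ d) (hd : 3 ≤ d)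
    (hθ : 256 ≤ θ) : ∀ᶠ n : ℕ in atTop, ∀ p : unitInterval,
      (p : ℝ) = (n : ℝ) ^ (-1 - 2 / (θ : ℝ) - 1 / 16 / (θ : ℝ) ^ (3 / 2 : ℝ)) →
      1 / 2 < probSubtorusOpen n d i θ p := by
  have hθ0 : (0 : ℝ) < θ := by exact_mod_cast (by omega : 0 < θ)
  have hθ1 : (1 : ℝ) ≤ θ := by exact_mod_cast (by omega : 1 ≤ θ)
  obtain ⟨s, hs1, hs2⟩ : ∃ s, θ ≤ 2 * s ∧ 2 * s ≤ θ + 1 := ⟨(θ + 1) / 2, by omega, by omega⟩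
  set k := Nat.sqrt θ with hk
  have hkk : k * k ≤ θ := Nat.sqrt_le θ
  have hks : k ≤ s := by nlinarith
  have hk1 : √(θ : ℝ) - 1 ≤ k := by
    have : (θ : ℝ) ≤ (k + 1) ^ 2 := by exact_mod_cast (Nat.lt_succ_sqrt' θ).le
    have := Real.sqrt_le_sqrt this
    rw [Real.sqrt_sq (by positivity)] at this
    linarith
  have hk2 : (k : ℝ) ≤ √θ := Real.le_sqrt_of_sq_le (by rw [sq]; exact_mod_cast hkk)
  set b : ℝ := 2 / θ + 1 / 16 / (θ * √θ) with hb
  have hb0 : 0 < b := by positivity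
  obtain ⟨hε0, hε, hweak⟩ := supercritical_exponents (θ := θ) (s := s) (k := k)
    (by exact_mod_cast hθ) (by exact_mod_cast hs1) (by exact_mod_cast hs2) hk1 hk2 hb
  set κ : ℝ := 1 / (12 * θ) with hκ
  have hκ0 : 0 < κ := by positivity
  have hκ1 : κ ≤ 1 := by rw [hκ, div_le_one (by positivity)]; linarith
  set K₁ : ℝ := κ ^ (s - k) / (6 * θ) with hK₁
  set K₂ : ℝ := κ ^ s / (6 * θ) with hK₂
  have hK₁0 : 0 < K₁ := by positivity
  have hK₂0 : 0 < K₂ := by positivity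
  have hK₂1 : K₂ ≤ 1 := by
    rw [hK₂, div_le_one (by positivity)]
    exact (pow_le_one₀ hκ0.le hκ1).trans (by linarith)
  set K₃ : ℝ := ((1 / 2) ^ θ * (K₂ / 2) ^ k) ^ 2 with hK₃
  have hK₃0 : 0 < K₃ := by positivity
  have hbig : Tendsto (fun n : ℕ => K₁ * (n : ℝ) ^ (1 - b * (s - k : ℝ))) atTop atTop :=
    ((tendsto_rpow_atTop (by linarith)).comp tendsto_natCast_atTop_atTop).const_mul_atTop hK₁0
  filter_upwards [eventually_ge_atTop (6 * θ), hbig.eventually_ge_atTop 1,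
    eventually_pow_mul_exp_lt (K := K₃ / (6 * θ)) (c := 1 / (2 * θ)) (by positivity)
      (by positivity) d] with n hn hn_weak hn_exp p hp
  have hn0 : 0 < n := by omega
  have hn0' : (0 : ℝ) < n := by exact_mod_cast hn0
  have hn1' : (1 : ℝ) ≤ n := by exact_mod_cast hn0
  -- Each coordinate is cut into `3 * θ` blocks: `2 * θ` to index lines and `θ` for the open
  -- vertices on them. Since `6 * θ ≤ n`, rounding down loses at most a factor of two.
  set g := n / (3 * θ) with hg
  have hgn : 3 * θ * g ≤ n := Nat.mul_div_le n (3 * θ)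
  have hg0 : 0 < g := Nat.div_pos (by omega) (by omega)
  have hgl : (n : ℝ) / (6 * θ) ≤ g := by
    have h1 : n < 3 * θ * (g + 1) := Nat.lt_mul_div_succ n (by omega)
    have h2 : n ≤ g * (6 * θ) := by nlinarith
    rw [div_le_iff₀ (by positivity)]
    exact_mod_cast h2
  have hnp : n * (p : ℝ) = (n : ℝ) ^ (-b) := by
    rw [hp]
    nth_rewrite 1 [← Real.rpow_one (n : ℝ)]
    rw [← Real.rpow_add hn0', rpow_three_halves hθ0, hb]
    ring_nf
  have hp0 : (0 : ℝ) ≤ p := p.2.1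
  obtain ⟨t, ht⟩ : ∃ t : ℝ, t = g * p / (1 + g * p) := ⟨_, rfl⟩
  have ht_ge : κ * (n : ℝ) ^ (-b) ≤ t := by
    rw [ht]
    exact le_blockDensity hn1' hθ1 hb0.le hgl hp0 hnp
  have hpow (m : ℕ) : κ ^ m / (6 * θ) * (n : ℝ) ^ (1 - b * m) ≤ g * t ^ m :=
    le_mul_pow hn0' hθ0 hκ0.le hgl ht_ge m
  have hweak' : 1 / 2 ≤ g * t ^ (s - k) / (1 + g * t ^ (s - k)) := by
    refine half_le_div_one_add zero_le_one le_rfl (le_trans ?_ (hpow (s - k)))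
    rw [Nat.cast_sub hks]
    exact hn_weak
  have hstrong : K₂ / 2 * (n : ℝ) ^ (-(b * s - 1)) ≤ g * t ^ s / (1 + g * t ^ s) := by
    have h1 : (n : ℝ) ^ (-(b * s - 1)) ≤ 1 :=
      Real.rpow_le_one_of_one_le_of_nonpos hn1' (by linarith)
    have h2 := half_le_div_one_add (y := K₂ * (n : ℝ) ^ (-(b * s - 1))) (by positivity)
      (mul_le_one₀ hK₂1 (by positivity) h1) (x := g * t ^ s)
      (by rw [neg_sub]; exact hpow s)
    linarith
  -- A lower bound for the probability that a plane fills: each of the `2 * k` strong lines costs `n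
  -- ^ (b * s - 1)`, in total at most `n ^ (1/4)`. Any exponent below one would leave `q * g`
  -- growing as a power of `n`.
  set q : ℝ := K₃ * (n : ℝ) ^ (-(1 / 4) : ℝ) with hq
  have hq0 : 0 ≤ q := by positivity
  have hqle : q ≤ ((g * t ^ (s - k) / (1 + g * t ^ (s - k))) ^ θ *
      (g * t ^ s / (1 + g * t ^ s)) ^ k) ^ 2 := by
    calc q ≤ K₃ * (n : ℝ) ^ (-(2 * k * (b * s - 1))) := by
          rw [hq]
          gcongr
      _ = ((1 / 2) ^ θ * (K₂ / 2 * (n : ℝ) ^ (-(b * s - 1))) ^ k) ^ 2 := by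
          rw [mul_pow (K₂ / 2), ← mul_assoc, mul_pow _ (((n : ℝ) ^ (-(b * s - 1))) ^ k), ← hK₃,
            ← Real.rpow_natCast _ k, ← Real.rpow_natCast _ 2, ← Real.rpow_mul hn0'.le,
            ← Real.rpow_mul hn0'.le]
          push_cast
          ring_nf
      _ ≤ _ := by gcongr
  have hq1 : q ≤ 1 := by
    have h1 : K₃ ≤ 1 := by
      rw [hK₃]
      refine pow_le_one₀ (by positivity) (mul_le_one₀ (pow_le_one₀ (by norm_num) (by norm_num))
        (by positivity) (pow_le_one₀ (by positivity) (by linarith)))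
    exact mul_le_one₀ h1 (by positivity)
      (Real.rpow_le_one_of_one_le_of_nonpos hn1' (by norm_num))
  have hmain := one_sub_le_probSubtorusOpen (i := i) (d := d) hid hd hg0 hs1 (by omega : s ≤ θ)
    (by nlinarith : k ≤ θ) hgn hn0 p ht hqle
  refine lt_of_lt_of_le ?_ hmain
  have hqg : K₃ / (6 * θ) * (n : ℝ) ^ (3 / 4 : ℝ) ≤ q * g := by
    calc K₃ / (6 * θ) * (n : ℝ) ^ (3 / 4 : ℝ) = q * (n / (6 * θ)) := by
          rw [hq, show (3 / 4 : ℝ) = -(1 / 4) + 1 by norm_num, Real.rpow_add hn0', Real.rpow_one]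
          ring
      _ ≤ q * g := by gcongr
  have hexp : (1 - q) ^ g ≤ Real.exp (-(K₃ / (6 * θ) * (n : ℝ) ^ (3 / 4 : ℝ))) :=
    (one_sub_pow_le_exp hq1 g).trans (Real.exp_le_exp.2 (neg_le_neg hqg))
  have h1 : (n : ℝ) ^ d * (θ * (1 - q) ^ g) < 1 / 2 := by
    calc (n : ℝ) ^ d * (θ * (1 - q) ^ g)
        = θ * ((n : ℝ) ^ d * (1 - q) ^ g) := by ring
      _ ≤ θ * ((n : ℝ) ^ d * Real.exp (-(K₃ / (6 * θ) * (n : ℝ) ^ (3 / 4 : ℝ)))) := by gcongr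
      _ < θ * (1 / (2 * θ)) := by gcongr
      _ = 1 / 2 := by field_simp
  linarith

end UpperBound

end HammingBootstrap

theorem theorem2p5 (i d : ℕ) (hi : 2 ≤ i) (hid : i ≤ d) (hd : 3 ≤ d) :
    ∃ c C : ℝ, 0 < c ∧ 0 < C ∧ ∃ θ₀ : ℕ, ∀ θ : ℕ, θ₀ ≤ θ → ∃ N : ℕ, ∀ n : ℕ, N ≤ n →
      (∃! p : unitInterval, HammingBootstrap.IsThreshold n d i θ p) ∧
      ∀ p : unitInterval, HammingBootstrap.IsThreshold n d i θ p →
        (n : ℝ) ^ (-1 - 2 / (θ : ℝ) - C / (θ : ℝ) ^ (3 / 2 : ℝ)) ≤ (p : ℝ) ∧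
        (p : ℝ) ≤ (n : ℝ) ^ (-1 - 2 / (θ : ℝ) - c / (θ : ℝ) ^ (3 / 2 : ℝ)) := by
  refine ⟨1 / 16, 100 * (d : ℝ) ^ 2, by norm_num, by positivity, max 256 (64 * d ^ 4),
    fun θ hθ => ?_⟩
  have hθ1 : 256 ≤ θ := (le_max_left _ _).trans hθ
  have hθ2 : 64 * d ^ 4 ≤ θ := (le_max_right _ _).trans hθ
  obtain ⟨N₁, hN₁⟩ := HammingBootstrap.probSubtorusOpen_lt_half hi (by omega : 2 ≤ d) hθ2
  obtain ⟨N₂, hN₂⟩ := Filter.eventually_atTop.1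
    (HammingBootstrap.eventually_half_lt_probSubtorusOpen hid hd hθ1)
  refine ⟨max 1 (max N₁ N₂), fun n hn => ?_⟩
  have hn0 : 0 < n := (le_max_left _ _).trans hn
  have hn1 : N₁ ≤ n := ((le_max_left _ _).trans (le_max_right _ _)).trans hn
  have hn2 : N₂ ≤ n := ((le_max_right _ _).trans (le_max_right _ _)).trans hn
  have hθ0 : 0 < θ := by omega
  refine ⟨HammingBootstrap.existsUnique_isThreshold hid hn0 hθ0, fun p hp => ⟨?_, ?_⟩⟩
  · by_contra hlt
    have h := hN₁ n hn1 p (not_le.1 hlt).le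
    rw [HammingBootstrap.IsThreshold] at hp
    linarith
  · have hn1' : (1 : ℝ) ≤ n := by exact_mod_cast hn0
    have hpos : 0 ≤ 2 / (θ : ℝ) + 1 / 16 / (θ : ℝ) ^ (3 / 2 : ℝ) := by positivity
    -- The supercritical estimate is known only at this one point; strict monotonicity in `p` turns
    -- it into a bound on the threshold.
    let r : unitInterval := ⟨(n : ℝ) ^ (-1 - 2 / (θ : ℝ) - 1 / 16 / (θ : ℝ) ^ (3 / 2 : ℝ)),
      by positivity, Real.rpow_le_one_of_one_le_of_nonpos hn1' (by linarith)⟩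
    have h := hN₂ n hn2 r rfl
    rw [HammingBootstrap.IsThreshold] at hp
    rw [← hp] at h
    exact ((HammingBootstrap.probSubtorusOpen_strictMono hid hn0 hθ0).lt_iff_lt.1 h).le
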